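/- Let $H^2$ be the Hardy space of the unit disk $\mathbb D$: the Hilbert space of analytic functions $f$ on $\mathbb D$ with $\|f\|^2=\sup_{0<r<1}\frac1{2\pi}\int_0^{2\pi}|f(re^{it})|^2\,dt<\infty$. For $\mathbf a\subset\mathbb D$ put $\mathcal Z_{\mathbf a}=\{f\in H^2: f(z)=0 \text{ for all } z\in\mathbf a\}$ and $\lim\mathbf a=\overline{\mathbf a}\setminus\mathbf a$. Let $\mathbf a,\mathbf b\subset\mathbb D$ be disjoint infinite sets satisfying Blaschke's condition ($\sum_{z\in\mathbf a}(1-|z|)<\infty$ and $\sum_{z\in\mathbf b}(1-|z|)<\infty$) and such that neither of the sets $\lim\mathbf a$, $\lim\mathbf b$ is contained in the other. Then $$\mathcal Z_{\mathbf a}\cap\mathcal Z_{\mathbf b}^\perp=\mathcal Z_{\mathbf a}^\perp\cap\mathcal Z_{\mathbf b}=\{0\}.$$ Consequently there is a unique minimal geodesic of the Grassmann manifold of $H^2$ joining $\mathcal Z_{\mathbf a}$ and $\mathcal Z_{\mathbf b}$. More precisely: 1. There is exactly one bounded self-adjoint operator $X$ on $H^2$ with $\|X\|\le\pi/2$ that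 is co-diagonal with respect to both subspaces, i.e. $X\mathcal Z_{\mathbf a}\subset\mathcal Z_{\mathbf a}^\perp$, $X\mathcal Z_{\mathbf a}^\perp\subset\mathcal Z_{\mathbf a}$, $X\mathcal Z_{\mathbf b}\subset\mathcal Z_{\mathbf b}^\perp$, $X\mathcal Z_{\mathbf b}^\perp\subset\mathcal Z_{\mathbf b}$, and satisfies $e^{iX}\mathcal Z_{\mathbf a}=\mathcal Z_{\mathbf b}$. 2. There is exactly one minimal geodesic $\delta:[0,1]\to\mathrm{Gr}(H^2)$ with $\delta(0)=\mathcal Z_{\mathbf a}$ and $\delta(1)=\mathcal Z_{\mathbf b}$, and it is given by $\delta(t)=e^{itX}\mathcal Z_{\mathbf a}$. Here the Grassmann manifold $\mathrm{Gr}(H^2)$ is the set of closed subspaces of $H^2$, each identified with the orthogonal projection onto it, regarded as a subset of the Banach space of bounded operators. A geodesic is a smooth curve $\delta:[0,1]\to\mathrm{Gr}(H^2)$ with $E_{\delta(t)}(\ddot\delta(t))=0$ for all $t\in[0,1]$, where $E_P(Y)=PY(1-P)+(1-P)YP$. The length of a piecewise smooth curve $\gamma:[0,1]\to\mathrm{Gr}(H^2)$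 is $\int_0^1\|\dot\gamma(t)\|\,dt$ (operator norm). A geodesic is minimal if its length is at most that of every piecewise smooth curve in $\mathrm{Gr}(H^2)$ with the same endpoints. -/

import Mathlib

open Set Filter Topology
open scoped Nat ContDiff

noncomputable section

/-! ### The Hardy space of the unit disk -/

namespace Hardy

/-- The mean `(1/2π) ∫₀^{2π} |f(r e^{it})|² dt`. -/
def mean (f : ℂ → ℂ) (r : ℝ) : ℝ := Real.circleAverage (fun z => ‖f z‖ ^ 2) 0 r

/-- `f` is (the extension by zero outside the open unit disk of) an analytic function on the disk
whose quadratic means over the circles of radius `r`, `0 < r < 1`, are bounded. -/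
structure IsHardy (f : ℂ → ℂ) : Prop where
  zero_off : ∀ z : ℂ, 1 ≤ ‖z‖ → f z = 0
  analytic : DifferentiableOn ℂ f (Metric.ball 0 1)
  bdd : BddAbove (mean f '' Ioo 0 1)

/-- The `n`-th Taylor coefficient at the origin. -/
def taylor (f : ℂ → ℂ) (n : ℕ) : ℂ := (n ! : ℂ)⁻¹ * iteratedDeriv n f 0

lemma hasSum_taylor {f : ℂ → ℂ} (hf : DifferentiableOn ℂ f (Metric.ball 0 1)) {z : ℂ}
    (hz : ‖z‖ < 1) : HasSum (fun n => taylor f n * z ^ n) (f z) := by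
  have h := Complex.hasSum_taylorSeries_on_ball hf (z := z) (by simpa using hz)
  have he : (fun n => taylor f n * z ^ n)
      = fun n : ℕ => (n ! : ℂ)⁻¹ • (z - 0) ^ n • iteratedDeriv n f 0 := by
    funext n
    simp only [taylor, sub_zero, smul_eq_mul]
    ring
  rwa [he]

/-- Parseval's identity on the circle of radius `r`. -/
lemma hasSum_mean {f : ℂ → ℂ} (hf : DifferentiableOn ℂ f (Metric.ball 0 1)) {r : ℝ}
    (h0 : 0 ≤ r) (h1 : r < 1) :
    HasSum (fun n => ‖taylor f n‖ ^ 2 * (r ^ n) ^ 2) (mean f r) := by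
  have hs : Summable (fun n => ‖taylor f n‖ * r ^ n) := by
    have := (hasSum_taylor hf (z := (r : ℂ))
      (by rwa [Complex.norm_real, Real.norm_of_nonneg h0])).summable.norm
    simpa [abs_of_nonneg h0] using this
  rw [hasSum_iff_tendsto_nat_of_nonneg (fun n => by positivity)]
  let p : ℕ → Polynomial ℂ := fun N =>
    ∑ n ∈ Finset.range N, Polynomial.monomial n (taylor f n * (r : ℂ) ^ n)
  have hcoeff : ∀ N n, (p N).coeff n
      = if n < N then taylor f n * (r : ℂ) ^ n else 0 := by
    intro N n
    simp [p, Polynomial.coeff_monomial]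
  have heval : ∀ N z, (p N).eval z
      = ∑ n ∈ Finset.range N, taylor f n * ((r : ℂ) * z) ^ n := by
    intro N z
    simp [p, Polynomial.eval_finsetSum, mul_pow, mul_assoc]
  have hsum : ∀ N, ∑ n ∈ Finset.range N, ‖taylor f n‖ ^ 2 * (r ^ n) ^ 2
      = Real.circleAverage (fun z => ‖(p N).eval z‖ ^ 2) 0 1 := by
    intro N
    rw [← Polynomial.sum_sq_norm_coeff_eq_circleAverage]
    have hsub : (p N).support ⊆ Finset.range N := by
      intro n hn
      rw [Polynomial.mem_support_iff, hcoeff] at hn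
      simp only [Finset.mem_range]
      by_contra hc
      simp [hc] at hn
    rw [Finset.sum_subset hsub (fun n _ hn => by
      rw [Polynomial.notMem_support_iff] at hn
      simp [hn])]
    refine Finset.sum_congr rfl fun n hn => ?_
    rw [hcoeff, if_pos (Finset.mem_range.1 hn)]
    simp [abs_of_nonneg h0, mul_pow]
  simp_rw [hsum]
  unfold mean
  rw [Real.circleAverage_eq_circleAverage_zero_one (f := fun z => ‖f z‖ ^ 2)]
  simp only [Real.circleAverage, add_zero]
  refine Tendsto.const_smul ?_ _
  have hnorm : ∀ t : ℝ, ‖circleMap 0 1 t‖ = 1 := fun t => by simp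
  refine intervalIntegral.tendsto_integral_filter_of_dominated_convergence
    (fun _ => (∑' n, ‖taylor f n‖ * r ^ n) ^ 2) ?_ ?_ intervalIntegrable_const ?_
  · refine Eventually.of_forall fun N => Continuous.aestronglyMeasurable ?_
    have := (p N).continuous
    fun_prop
  · refine Eventually.of_forall fun N => Eventually.of_forall fun t _ => ?_
    rw [norm_pow, norm_norm]
    refine pow_le_pow_left₀ (norm_nonneg _) ?_ 2
    rw [heval]
    refine (norm_sum_le _ _).trans ?_
    refine le_trans (le_of_eq (Finset.sum_congr rfl fun n _ => ?_))
      (hs.sum_le_tsum (Finset.range N) (fun n _ => by positivity))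
    simp [abs_of_nonneg h0]
  · refine Eventually.of_forall fun t _ => ?_
    have := (hasSum_taylor hf (z := (r : ℂ) * circleMap 0 1 t)
      (by rw [norm_mul, hnorm, Complex.norm_real, Real.norm_of_nonneg h0, mul_one]; exact h1))
    simp_rw [heval]
    exact (this.tendsto_sum_nat.norm).pow 2

lemma summable_taylor {f : ℂ → ℂ} (hf : IsHardy f) : Summable (fun n => ‖taylor f n‖ ^ 2) := by
  obtain ⟨M, hM⟩ := hf.bdd
  refine summable_of_sum_range_le (c := M) (fun n => by positivity) fun N => ?_
  have ht : Tendsto (fun r : ℝ => ∑ n ∈ Finset.range N, ‖taylor f n‖ ^ 2 * (r ^ n) ^ 2)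
      (𝓝[<] 1) (𝓝 (∑ n ∈ Finset.range N, ‖taylor f n‖ ^ 2 * ((1 : ℝ) ^ n) ^ 2)) := by
    refine Tendsto.mono_left (Continuous.tendsto ?_ 1) nhdsWithin_le_nhds
    fun_prop
  simp only [one_pow, mul_one] at ht
  refine le_of_tendsto ht ?_
  filter_upwards [Ioo_mem_nhdsLT (show (0 : ℝ) < 1 by norm_num)] with r hr
  exact ((hasSum_mean hf.analytic hr.1.le hr.2).summable.sum_le_tsum _
    (fun n _ => by positivity)).trans
    ((hasSum_mean hf.analytic hr.1.le hr.2).tsum_eq.le.trans (hM ⟨r, hr, rfl⟩))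

lemma mean_le {f : ℂ → ℂ} (hf : DifferentiableOn ℂ f (Metric.ball 0 1))
    (hs : Summable (fun n => ‖taylor f n‖ ^ 2)) {r : ℝ} (hr : r ∈ Ioo (0 : ℝ) 1) :
    mean f r ≤ ∑' n, ‖taylor f n‖ ^ 2 := by
  refine hasSum_le (fun n => ?_) (hasSum_mean hf hr.1.le hr.2) hs.hasSum
  refine mul_le_of_le_one_right (by positivity) ?_
  exact pow_le_one₀ (pow_nonneg hr.1.le n) (pow_le_one₀ hr.1.le hr.2.le)

lemma isHardy_of_summable {f : ℂ → ℂ} (h0 : ∀ z : ℂ, 1 ≤ ‖z‖ → f z = 0)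
    (hf : DifferentiableOn ℂ f (Metric.ball 0 1))
    (hs : Summable (fun n => ‖taylor f n‖ ^ 2)) : IsHardy f :=
  ⟨h0, hf, ⟨_, by rintro _ ⟨r, hr, rfl⟩; exact mean_le hf hs hr⟩⟩

/-- The supremum of the means is the `ℓ²` norm squared of the Taylor coefficients. -/
lemma sSup_mean {f : ℂ → ℂ} (hf : IsHardy f) :
    sSup (mean f '' Ioo 0 1) = ∑' n, ‖taylor f n‖ ^ 2 := by
  have hs := summable_taylor hf
  apply le_antisymm
  · refine csSup_le ⟨_, 1 / 2, by norm_num, rfl⟩ ?_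
    rintro _ ⟨r, hr, rfl⟩
    exact mean_le hf.analytic hs hr
  · refine hs.tsum_le_of_sum_range_le fun N => ?_
    have ht : Tendsto (fun r : ℝ => ∑ n ∈ Finset.range N, ‖taylor f n‖ ^ 2 * (r ^ n) ^ 2)
        (𝓝[<] 1) (𝓝 (∑ n ∈ Finset.range N, ‖taylor f n‖ ^ 2 * ((1 : ℝ) ^ n) ^ 2)) := by
      refine Tendsto.mono_left (Continuous.tendsto ?_ 1) nhdsWithin_le_nhds
      fun_prop
    simp only [one_pow, mul_one] at ht
    refine le_of_tendsto ht ?_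
    filter_upwards [Ioo_mem_nhdsLT (show (0 : ℝ) < 1 by norm_num)] with r hr
    exact ((hasSum_mean hf.analytic hr.1.le hr.2).summable.sum_le_tsum _
      (fun n _ => by positivity)).trans
      ((hasSum_mean hf.analytic hr.1.le hr.2).tsum_eq.le.trans
        (le_csSup hf.bdd ⟨r, hr, rfl⟩))

lemma contDiffAt_zero {f : ℂ → ℂ} (hf : DifferentiableOn ℂ f (Metric.ball 0 1)) (n : ℕ) :
    ContDiffAt ℂ n f 0 :=
  (hf.contDiffOn Metric.isOpen_ball).contDiffAt (Metric.ball_mem_nhds 0 one_pos)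

lemma taylor_add {f g : ℂ → ℂ} (hf : DifferentiableOn ℂ f (Metric.ball 0 1))
    (hg : DifferentiableOn ℂ g (Metric.ball 0 1)) (n : ℕ) :
    taylor (f + g) n = taylor f n + taylor g n := by
  simp only [taylor]
  rw [iteratedDeriv_add (contDiffAt_zero hf n) (contDiffAt_zero hg n), mul_add]

lemma taylor_smul {f : ℂ → ℂ} (hf : DifferentiableOn ℂ f (Metric.ball 0 1)) (c : ℂ) (n : ℕ) :
    taylor (c • f) n = c * taylor f n := by
  simp only [taylor]
  rw [iteratedDeriv_const_smul (contDiffAt_zero hf n) c, smul_eq_mul]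
  ring

/-- The analytic functions on the disk with bounded quadratic means form a vector space. -/
def hardySubmodule : Submodule ℂ (ℂ → ℂ) where
  carrier := {f | IsHardy f}
  zero_mem' := ⟨fun _ _ => rfl, differentiableOn_const 0, ⟨0, by
    rintro _ ⟨r, _, rfl⟩
    simp [mean, Real.circleAverage]⟩⟩
  add_mem' := by
    intro f g hf hg
    have hd := hf.analytic.add hg.analytic
    refine isHardy_of_summable (fun z hz => by simp [hf.zero_off z hz, hg.zero_off z hz]) hd ?_
    refine Summable.of_nonneg_of_le (fun n => by positivity) (fun n => ?_)
      (((summable_taylor hf).mul_left 2).add ((summable_taylor hg).mul_left 2))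
    rw [taylor_add hf.analytic hg.analytic]
    have h1 := norm_add_le (taylor f n) (taylor g n)
    nlinarith [sq_nonneg (‖taylor f n‖ - ‖taylor g n‖), norm_nonneg (taylor f n + taylor g n),
      norm_nonneg (taylor f n), norm_nonneg (taylor g n)]
  smul_mem' := by
    intro c f hf
    refine isHardy_of_summable (fun z hz => by simp [hf.zero_off z hz])
      (hf.analytic.const_smul c) ?_
    simp_rw [taylor_smul hf.analytic, norm_mul, mul_pow]
    exact (summable_taylor hf).mul_left _

/-- The Hardy space `H²` of the unit disk. -/
def H2 : Type := hardySubmodule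

namespace H2

instance : AddCommGroup H2 := inferInstanceAs (AddCommGroup hardySubmodule)
instance : Module ℂ H2 := inferInstanceAs (Module ℂ hardySubmodule)

/-- The underlying function. -/
def toFun (f : H2) : ℂ → ℂ := Subtype.val (p := fun f => f ∈ hardySubmodule) f

instance : CoeFun H2 (fun _ => ℂ → ℂ) := ⟨toFun⟩

lemma isHardy (f : H2) : IsHardy f := Subtype.property (p := fun f => f ∈ hardySubmodule) f

lemma toFun_injective : Function.Injective toFun := Subtype.val_injective

@[simp] lemma toFun_add (f g : H2) : (f + g).toFun = f.toFun + g.toFun := rfl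
@[simp] lemma toFun_smul (c : ℂ) (f : H2) : (c • f).toFun = c • f.toFun := rfl
@[simp] lemma toFun_zero : (0 : H2).toFun = 0 := rfl

/-- The sequence of Taylor coefficients, as an element of `ℓ²`. -/
def coeffs : H2 →ₗ[ℂ] lp (fun _ : ℕ => ℂ) 2 where
  toFun f := ⟨taylor f, by
    refine (memℓp_gen_iff (E := fun _ : ℕ => ℂ) (f := taylor f) (by norm_num)).2 ?_
    simpa using summable_taylor f.isHardy⟩
  map_add' f g := by
    ext n
    exact taylor_add f.isHardy.analytic g.isHardy.analytic n
  map_smul' c f := by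
    ext n
    exact taylor_smul f.isHardy.analytic c n

lemma coeffs_apply (f : H2) (n : ℕ) : coeffs f n = taylor f n := rfl

lemma coeffs_injective : Function.Injective coeffs := by
  intro f g h
  apply toFun_injective
  funext z
  by_cases hz : ‖z‖ < 1
  · refine (hasSum_taylor f.isHardy.analytic hz).unique ?_
    convert hasSum_taylor g.isHardy.analytic hz using 3 with n
    rw [← coeffs_apply, ← coeffs_apply, h]
  · rw [f.isHardy.zero_off z (not_lt.1 hz), g.isHardy.zero_off z (not_lt.1 hz)]

lemma coeffs_surjective : Function.Surjective coeffs := by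
  intro c
  have hc : Summable (fun n => ‖c n‖ ^ 2) := by
    have := (memℓp_gen_iff (by norm_num)).1 c.2
    simpa using this
  let p := FormalMultilinearSeries.ofScalars ℂ (fun n => c n)
  have hr : (1 : ENNReal) ≤ p.radius := by
    refine FormalMultilinearSeries.le_radius_of_bound p ‖c‖ (r := 1) fun n => ?_
    simpa [p] using lp.norm_apply_le_norm (by norm_num) c n
  have hp := p.hasFPowerSeriesOnBall (lt_of_lt_of_le one_pos hr)
  let f : ℂ → ℂ := fun z => if ‖z‖ < 1 then p.sum z else 0
  have hf : HasFPowerSeriesOnBall f p 0 1 := by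
    refine (hp.mono one_pos hr).congr fun z hz => ?_
    have hz' : ‖z‖ < 1 := by
      rw [Metric.mem_eball, edist_zero_right, ← ofReal_norm, ENNReal.ofReal_lt_one] at hz
      exact hz
    simp [f, hz']
  have hd : DifferentiableOn ℂ f (Metric.ball 0 1) := by
    have := hf.differentiableOn
    rwa [← ENNReal.ofReal_one, Metric.eball_ofReal] at this
  have ht : ∀ n, taylor f n = c n := by
    intro n
    have := hf.factorial_smul 1 n
    rw [FormalMultilinearSeries.ofScalars_apply_eq, ← iteratedDeriv_eq_iteratedFDeriv] at this
    rw [taylor, ← this]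
    have : (n ! : ℂ) ≠ 0 := by exact_mod_cast n.factorial_ne_zero
    simp
    field_simp
  refine ⟨⟨f, isHardy_of_summable (fun z hz => by simp [f, not_lt.2 hz]) hd ?_⟩, ?_⟩
  · simpa [ht] using hc
  · ext n
    exact ht n

/-- The Hilbert space structure of `H²`. The norm is the usual one, see `norm_eq`. -/
instance : NormedAddCommGroup H2 := NormedAddCommGroup.induced H2 _ coeffs coeffs_injective
instance : InnerProductSpace ℂ H2 := InnerProductSpace.induced coeffs

lemma norm_coeffs (f : H2) : ‖coeffs f‖ = ‖f‖ := rfl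

/-- The unitary equivalence of `H²` with `ℓ²` given by the Taylor coefficients. -/
def coeffsEquiv : H2 ≃ₗᵢ[ℂ] lp (fun _ : ℕ => ℂ) 2 where
  toLinearEquiv := LinearEquiv.ofBijective coeffs ⟨coeffs_injective, coeffs_surjective⟩
  norm_map' := norm_coeffs

instance : CompleteSpace H2 :=
  (completeSpace_congr (e := coeffsEquiv.toLinearEquiv.toEquiv)
    coeffsEquiv.isometry.isUniformEmbedding).2 inferInstance

/-- The norm of `H²` is `(sup_{0<r<1} (1/2π) ∫₀^{2π} |f(r e^{it})|² dt)^{1/2}`. -/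
theorem norm_eq (f : H2) : ‖f‖ = √(sSup (mean f '' Ioo 0 1)) := by
  rw [sSup_mean f.isHardy, ← norm_coeffs, ← Real.sqrt_sq (norm_nonneg (coeffs f))]
  congr 1
  have := lp.norm_rpow_eq_tsum (p := 2) (by norm_num) (coeffs f)
  simpa [coeffs_apply] using this

end H2

/-- The subspace `Z_a` of the functions in `H²` that vanish at all points of `a`. -/
def zeroSpace (a : Set ℂ) : Submodule ℂ H2 where
  carrier := {f | ∀ z ∈ a, f z = 0}
  zero_mem' := fun _ _ => rfl
  add_mem' := fun {f g} hf hg z hz => by simp [hf z hz, hg z hz]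
  smul_mem' := fun c f hf z hz => by simp [hf z hz]

/-- An infinite set of points of the open unit disk which satisfies Blaschke's condition
`∑ (1 - |z|) < ∞`. -/
structure IsInfiniteBlaschkeSet (a : Set ℂ) : Prop where
  subset : a ⊆ Metric.ball 0 1
  infinite : a.Infinite
  summable : Summable (fun z : a => 1 - ‖(z : ℂ)‖)

/-- The limit set of `a`. -/
def limitSet (a : Set ℂ) : Set ℂ := closure a \ a

end Hardy

/-! ### Geodesics of the Grassmann manifold of a Hilbert space -/

namespace Grassmann

variable {H : Type*} [NormedAddCommGroup H] [InnerProductSpace ℂ H] [CompleteSpace H]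

/-- The Grassmann manifold: the closed subspaces of `H`, represented by the orthogonal
projections onto them. -/
def Gr (H : Type*) [NormedAddCommGroup H] [InnerProductSpace ℂ H] [CompleteSpace H] :
    Set (H →L[ℂ] H) := {P | IsStarProjection P}

/-- The projection `X ↦ P X (1 - P) + (1 - P) X P` onto the tangent space at `P`. -/
def tangentProj (P X : H →L[ℂ] H) : H →L[ℂ] H := P * X * (1 - P) + (1 - P) * X * P

/-- `γ`, restricted to `[0,1]`, is a piecewise smooth curve in the Grassmann manifold
(which is a submanifold of the Banach space of bounded operators). -/
def IsPiecewiseSmoothCurve (γ : ℝ → (H →L[ℂ] H)) : Prop :=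
  (∀ t ∈ Icc (0 : ℝ) 1, γ t ∈ Gr H) ∧
    ∃ (n : ℕ) (s : ℕ → ℝ), Monotone s ∧ s 0 = 0 ∧ s n = 1 ∧
      ∀ i < n, ContDiffOn ℝ ∞ γ (Icc (s i) (s (i + 1)))

/-- The curve `γ : [0,1] → Gr` joins the subspaces `S` and `T`. -/
def Joins (γ : ℝ → (H →L[ℂ] H)) (S T : Submodule ℂ H) : Prop :=
  (γ 0).range = S ∧ (γ 1).range = T

/-- The length of a curve for the Finsler metric given by the operator norm. -/
def length (γ : ℝ → (H →L[ℂ] H)) : ℝ := ∫ t in (0 : ℝ)..1, ‖deriv γ t‖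

/-- `γ`, restricted to `[0,1]`, is a geodesic of the Grassmann manifold: a smooth curve whose
velocity has zero covariant derivative for the connection `DX/dt = E_γ(X')`, where
`E_P` is the projection onto the tangent space at `P`. -/
def IsGeodesic (γ : ℝ → (H →L[ℂ] H)) : Prop :=
  (∀ t ∈ Icc (0 : ℝ) 1, γ t ∈ Gr H) ∧ ContDiffOn ℝ ∞ γ (Icc 0 1) ∧
    ∀ t ∈ Icc (0 : ℝ) 1,
      tangentProj (γ t) (derivWithin (derivWithin γ (Icc 0 1)) (Icc 0 1) t) = 0

/-- `γ` is a geodesic joining `S` and `T` that has minimal length among all the piecewise smooth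
curves of the Grassmann manifold that join `S` and `T`. -/
def IsMinimalGeodesic (γ : ℝ → (H →L[ℂ] H)) (S T : Submodule ℂ H) : Prop :=
  IsGeodesic γ ∧ Joins γ S T ∧
    ∀ β : ℝ → (H →L[ℂ] H), IsPiecewiseSmoothCurve β → Joins β S T → length γ ≤ length β

/-- `X` is a self-adjoint operator of norm at most `π/2`, co-diagonal with respect to `S` and to
`T`, such that `e^{iX} S = T`. -/
structure IsGeodesicExponent (X : H →L[ℂ] H) (S T : Submodule ℂ H) : Prop where
  selfAdjoint : IsSelfAdjoint X
  norm_le : ‖X‖ ≤ Real.pi / 2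
  codiagonal_left : (∀ f ∈ S, X f ∈ Sᗮ) ∧ (∀ f ∈ Sᗮ, X f ∈ S)
  codiagonal_right : (∀ f ∈ T, X f ∈ Tᗮ) ∧ (∀ f ∈ Tᗮ, X f ∈ T)
  map_eq : S.map (NormedSpace.exp (Complex.I • X)).toLinearMap = T

end Grassmann

end

noncomputable section

/-! ### Bounded analytic functions, reproducing kernels and the subspaces `Z_a` -/

namespace Hardy

open scoped InnerProductSpace ComplexConjugate

/-! The intersections are trivial by analytic continuation. `Z_b^⊥` is the closed span of the
kernels `1 / (1 - conj z * w)`, `z ∈ b`, whose poles are the reflections of the points of `b` in the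
unit circle. If `p` on the circle is not in the closure of `b`, then near `p` the values of a finite
kernel sum are bounded by a constant times its `H²` norm (`exists_uniform_bound`). Hence norm
convergence implies uniform convergence near `p`, and every element of `Z_b^⊥` continues
analytically across `p`. For `f ∈ Z_a ∩ Z_b^⊥` and `p ∈ lim a \ lim b`, zeros of `f` accumulate at
`p`, so `f = 0`.

For the uniform bound, point evaluation inside the disk costs `1 / (1 - |w|)`. Outside, the value at
`w` is a pairing with an interpolating function built from a finite Blaschke product; Blaschke's
condition bounds its norm independently of the number of kernels. Both bounds have a first-order
singularity on the circle, which the maximum principle removes with the help of a quadratic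
polynomial.

For the geometry, let `R = 2P - 1` and `R' = 2Q - 1` be the reflections of the two subspaces.
Trivial intersections make `R + R'` injective. If `V = exp (iX)` with `X` co-diagonal, then `R' = V²
R` and `R + R' = (V R)(2 cos X)`, which is the polar decomposition when `‖X‖ ≤ π/2`. So `V R` must
be the sign of `R + R'`; this gives uniqueness (`exponent_unique`) and dictates the construction
(`exists_exponent`).

For minimality, the angle between a fixed unit vector and a moving subspace changes at speed at most
`‖γ'‖`. Endpoints of a curve of length `L ≤ π/2` are thus at distance at most `sin L`, while `‖sin
X‖ ≤ ‖P - Q‖`; hence `‖X‖ ≤ L` (`norm_le_length`). Conversely, the geodesic equation makes `γ' (2γ -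
1)` constant, so each geodesic is `exp (itZ) P exp (-itZ)`, of length `‖Z‖`. For a minimal one `‖Z‖
≤ ‖X‖ ≤ π/2`, and uniqueness of the exponent gives `Z = X`. -/

lemma mean_le_of_norm_le {f : ℂ → ℂ} (hf : DifferentiableOn ℂ f (Metric.ball 0 1)) {C : ℝ}
    (hC : ∀ z : ℂ, ‖z‖ < 1 → ‖f z‖ ≤ C) {r : ℝ} (hr : r ∈ Ioo (0 : ℝ) 1) : mean f r ≤ C ^ 2 := by
  have hs : Metric.sphere (0 : ℂ) |r| ⊆ Metric.ball 0 1 := by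
    intro z hz
    rw [mem_sphere_zero_iff_norm, abs_of_pos hr.1] at hz
    simpa [hz] using hr.2
  refine Real.circleAverage_mono_on_of_le_circle ?_ fun z hz => ?_
  · exact ((hf.continuousOn.mono hs).norm.pow 2).circleIntegrable'
  · exact pow_le_pow_left₀ (norm_nonneg _) (hC z (by simpa using hs hz)) 2

lemma isHardy_of_norm_le {f : ℂ → ℂ} (h0 : ∀ z : ℂ, 1 ≤ ‖z‖ → f z = 0)
    (hf : DifferentiableOn ℂ f (Metric.ball 0 1)) {C : ℝ}
    (hC : ∀ z : ℂ, ‖z‖ < 1 → ‖f z‖ ≤ C) : IsHardy f :=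
  ⟨h0, hf, ⟨C ^ 2, by rintro _ ⟨r, hr, rfl⟩; exact mean_le_of_norm_le hf hC hr⟩⟩

namespace H2

lemma norm_le_of_forall_norm_le (f : H2) {C : ℝ} (hC : ∀ z : ℂ, ‖z‖ < 1 → ‖f z‖ ≤ C) :
    ‖f‖ ≤ C := by
  have h0 : 0 ≤ C := (norm_nonneg _).trans (hC 0 (by simp))
  rw [norm_eq]
  refine Real.sqrt_le_iff.2 ⟨h0, csSup_le ⟨_, 1 / 2, by norm_num, rfl⟩ ?_⟩
  rintro _ ⟨r, hr, rfl⟩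
  exact mean_le_of_norm_le f.isHardy.analytic hC hr

/-- Restriction to the disk of a bounded analytic function. -/
lemma exists_of_norm_le {f : ℂ → ℂ} (hf : DifferentiableOn ℂ f (Metric.ball 0 1)) {C : ℝ}
    (hC : ∀ z : ℂ, ‖z‖ < 1 → ‖f z‖ ≤ C) : ∃ g : H2, (∀ z : ℂ, ‖z‖ < 1 → g z = f z) ∧ ‖g‖ ≤ C := by
  classical
  let g : ℂ → ℂ := fun z => if ‖z‖ < 1 then f z else 0
  have hg : ∀ z : ℂ, ‖z‖ < 1 → g z = f z := fun z hz => if_pos hz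
  have hgd : DifferentiableOn ℂ g (Metric.ball 0 1) :=
    hf.congr fun z hz => hg z (by simpa using hz)
  have hgC : ∀ z : ℂ, ‖z‖ < 1 → ‖g z‖ ≤ C := fun z hz => by rw [hg z hz]; exact hC z hz
  let G : H2 := ⟨g, isHardy_of_norm_le (fun z hz => if_neg (not_lt.2 hz)) hgd hgC⟩
  exact ⟨G, hg, norm_le_of_forall_norm_le G hgC⟩

lemma memlp_kernel {w : ℂ} (hw : ‖w‖ < 1) : Memℓp (fun n : ℕ => (conj w) ^ n) 2 := by
  refine (memℓp_gen_iff (by norm_num)).2 ?_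
  have : Summable fun n : ℕ => (‖w‖ ^ 2) ^ n :=
    summable_geometric_of_lt_one (by positivity) (by nlinarith [norm_nonneg w])
  refine this.congr fun n => ?_
  simp [← pow_mul, mul_comm]

open Classical in
/-- The reproducing kernel at the point `w` of the disk. -/
def kernel (w : ℂ) : H2 :=
  -- For `1 ≤ ‖w‖` the sequence is not square summable, so a default value is used.
  coeffsEquiv.symm (if hw : ‖w‖ < 1 then ⟨_, memlp_kernel hw⟩ else 0)

lemma coeffs_kernel {w : ℂ} (hw : ‖w‖ < 1) (n : ℕ) : coeffs (kernel w) n = (conj w) ^ n := by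
  have : coeffsEquiv (kernel w) = ⟨_, memlp_kernel hw⟩ := by
    rw [kernel, LinearIsometryEquiv.apply_symm_apply, dif_pos hw]
  exact congrFun (congrArg Subtype.val this) n

lemma inner_kernel {w : ℂ} (hw : ‖w‖ < 1) (f : H2) : ⟪kernel w, f⟫_ℂ = f w := by
  refine (lp.hasSum_inner (coeffs (kernel w)) (coeffs f)).unique ?_
  have h : ∀ n, ⟪coeffs (kernel w) n, coeffs f n⟫_ℂ = taylor f n * w ^ n := fun n => by
    rw [coeffs_kernel hw, coeffs_apply]
    simp
  simp_rw [h]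
  exact hasSum_taylor f.isHardy.analytic hw

lemma kernel_apply {w z : ℂ} (hw : ‖w‖ < 1) (hz : ‖z‖ < 1) :
    kernel w z = (1 - conj w * z)⁻¹ := by
  refine (hasSum_taylor (kernel w).isHardy.analytic hz).unique ?_
  have : HasSum (fun n : ℕ => (conj w * z) ^ n) (1 - conj w * z)⁻¹ :=
    hasSum_geometric_of_norm_lt_one (by
      rw [norm_mul, RCLike.norm_conj]; nlinarith [norm_nonneg w, norm_nonneg z])
  convert this using 2 with n
  rw [← coeffs_apply, coeffs_kernel hw, mul_pow]

/-- Comparison with the sup norm is cruder than the exact value `(1 - ‖w‖²)^(-1/2)`, but a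
first-order singularity at the circle is all that the later argument has to tolerate. -/
lemma norm_kernel_le {w : ℂ} (hw : ‖w‖ < 1) : ‖kernel w‖ ≤ (1 - ‖w‖)⁻¹ := by
  refine norm_le_of_forall_norm_le _ fun z hz => ?_
  rw [kernel_apply hw hz, norm_inv]
  refine inv_anti₀ (by linarith) ?_
  have h1 : ‖conj w * z‖ ≤ ‖w‖ := by
    rw [norm_mul, RCLike.norm_conj]; nlinarith [norm_nonneg w, norm_nonneg z]
  have h2 := norm_sub_norm_le 1 (conj w * z)
  rw [norm_one] at h2
  linarith

lemma norm_apply_le {w : ℂ} (hw : ‖w‖ < 1) (f : H2) : ‖f w‖ ≤ (1 - ‖w‖)⁻¹ * ‖f‖ := by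
  rw [← inner_kernel hw]
  exact (norm_inner_le_norm _ _).trans
    (mul_le_mul_of_nonneg_right (norm_kernel_le hw) (norm_nonneg _))

end H2

lemma zeroSpace_eq_orthogonal {a : Set ℂ} (ha : a ⊆ Metric.ball 0 1) :
    zeroSpace a = (Submodule.span ℂ (range fun z : a => H2.kernel z))ᗮ := by
  ext f
  have hk : ∀ z : a, ⟪H2.kernel z, f⟫_ℂ = f z := fun z => H2.inner_kernel (by simpa using ha z.2) f
  constructor
  · intro hf
    rw [Submodule.mem_orthogonal]
    intro u hu
    induction hu using Submodule.span_induction with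
    | mem x hx => obtain ⟨z, rfl⟩ := hx; rw [hk]; exact hf z z.2
    | zero => exact inner_zero_left _
    | add x y _ _ hx hy => rw [inner_add_left, hx, hy, add_zero]
    | smul c x _ hx => rw [inner_smul_left, hx, mul_zero]
  · intro hf z hz
    rw [← hk ⟨z, hz⟩]
    exact (Submodule.mem_orthogonal _ _).1 hf _ (Submodule.subset_span ⟨⟨z, hz⟩, rfl⟩)

lemma isClosed_zeroSpace {a : Set ℂ} (ha : a ⊆ Metric.ball 0 1) :
    IsClosed (zeroSpace a : Set H2) := by
  rw [zeroSpace_eq_orthogonal ha]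
  exact Submodule.isClosed_orthogonal _

lemma zeroSpace_orthogonal {a : Set ℂ} (ha : a ⊆ Metric.ball 0 1) :
    (zeroSpace a)ᗮ = (Submodule.span ℂ (range fun z : a => H2.kernel z)).topologicalClosure := by
  rw [zeroSpace_eq_orthogonal ha, Submodule.orthogonal_orthogonal_eq_closure]

/-! ### Blaschke products and interpolation -/

/-- The Blaschke factor with zero `z`. -/
def blaschkeFactor (z w : ℂ) : ℂ := (z - w) / (1 - conj z * w)

lemma one_sub_conj_mul_ne_zero {z w : ℂ} (hz : ‖z‖ < 1) (hw : ‖w‖ ≤ 1) : 1 - conj z * w ≠ 0 := by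
  intro h
  have : ‖conj z * w‖ = 1 := by rw [← sub_eq_zero.1 h, norm_one]
  rw [norm_mul, RCLike.norm_conj] at this
  nlinarith [norm_nonneg z, norm_nonneg w]

/-- Compares denominator and numerator of a Blaschke factor: the source of both the upper bound in
the disk and the lower bound away from the zero. -/
lemma normSq_one_sub_conj_mul (z w : ℂ) :
    ‖1 - conj z * w‖ ^ 2 = ‖z - w‖ ^ 2 + (1 - ‖w‖ ^ 2) * (1 - ‖z‖ ^ 2) := by
  simp only [← Complex.normSq_eq_norm_sq, Complex.normSq_apply]
  simp
  ring

lemma norm_blaschkeFactor_le {z w : ℂ} (hz : ‖z‖ < 1) (hw : ‖w‖ < 1) :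
    ‖blaschkeFactor z w‖ ≤ 1 := by
  have h := normSq_one_sub_conj_mul z w
  rw [blaschkeFactor, norm_div, div_le_one (norm_pos_iff.2 (one_sub_conj_mul_ne_zero hz hw.le))]
  refine (sq_le_sq₀ (norm_nonneg _) (norm_nonneg _)).1 ?_
  have := mul_nonneg (show 0 ≤ 1 - ‖w‖ ^ 2 by nlinarith [norm_nonneg w])
    (show 0 ≤ 1 - ‖z‖ ^ 2 by nlinarith [norm_nonneg z])
  linarith

/-- The inverse square is `1 + (1 - ‖w‖²)(1 - ‖z‖²) / ‖z - w‖²`, at most `1 + 2(1 - ‖z‖) / δ²`. In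
exponential form, a product over zeros becomes the Blaschke sum. -/
lemma inv_norm_blaschkeFactor_le {z w : ℂ} (hz : ‖z‖ < 1) {δ : ℝ} (hδ : 0 < δ)
    (h : δ ≤ ‖z - w‖) : ‖blaschkeFactor z w‖⁻¹ ≤ Real.exp ((1 - ‖z‖) / δ ^ 2) := by
  have hpos : 0 < ‖z - w‖ := hδ.trans_le h
  rw [blaschkeFactor, norm_div, inv_div]
  refine (sq_le_sq₀ (by positivity) (Real.exp_pos _).le).1 ?_
  rw [div_pow, normSq_one_sub_conj_mul, ← Real.exp_nat_mul, add_div, div_self (by positivity)]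
  have h1 : (1 - ‖w‖ ^ 2) * (1 - ‖z‖ ^ 2) / ‖z - w‖ ^ 2 ≤ (2 : ℕ) * ((1 - ‖z‖) / δ ^ 2) := by
    rw [← mul_div_assoc]
    refine div_le_div₀ ?_ ?_ (by positivity) (pow_le_pow_left₀ hδ.le h 2)
    · push_cast; nlinarith
    · push_cast
      have a1 : 0 ≤ 1 - ‖z‖ ^ 2 := by nlinarith [norm_nonneg z]
      have a2 : 1 - ‖z‖ ^ 2 ≤ 2 * (1 - ‖z‖) := by nlinarith [norm_nonneg z]
      have a3 : 1 - ‖w‖ ^ 2 ≤ 1 := by nlinarith [norm_nonneg w]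
      nlinarith
  have := Real.add_one_le_exp ((2 : ℕ) * ((1 - ‖z‖) / δ ^ 2))
  linarith

/-- Schwarz's lemma on the disk of radius `1 - ‖l‖` about `l`; off that disk, numerator and
denominator are estimated separately. -/
lemma norm_dslope_le {B : ℂ → ℂ} (hB : DifferentiableOn ℂ B (Metric.ball 0 1))
    (hB1 : ∀ z : ℂ, ‖z‖ < 1 → ‖B z‖ ≤ 1) {l z : ℂ} (hl : ‖l‖ < 1) (hz : ‖z‖ < 1) :
    ‖dslope B l z‖ ≤ 2 / (1 - ‖l‖) := by
  have hpos : 0 < 1 - ‖l‖ := by linarith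
  have h2 : ∀ w : ℂ, ‖w‖ < 1 → ‖B w - B l‖ ≤ 2 := fun w hw => by
    have := norm_sub_le (B w) (B l)
    linarith [hB1 w hw, hB1 l hl]
  by_cases h : z ∈ Metric.ball l (1 - ‖l‖)
  · have hsub : Metric.ball l (1 - ‖l‖) ⊆ Metric.ball 0 1 := by
      intro w hw
      rw [mem_ball_iff_norm] at hw
      rw [mem_ball_zero_iff]
      have := norm_add_le (w - l) l
      rw [sub_add_cancel] at this
      linarith
    refine Complex.norm_dslope_le_div_of_mapsTo_ball (hB.mono hsub) (fun w hw => ?_) h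
    rw [mem_closedBall_iff_norm]
    exact h2 w (by simpa using hsub hw)
  · rw [mem_ball_iff_norm, not_lt] at h
    have hne : z ≠ l := by
      rintro rfl
      rw [sub_self, norm_zero] at h
      linarith
    rw [dslope_of_ne _ hne, slope_def_field, norm_div]
    exact div_le_div₀ (by norm_num) (h2 z hz) hpos h

/-- Interpolation of a Cauchy kernel at finitely many points. -/
lemma exists_interpolation (F : Finset ℂ) (hF : ∀ z ∈ F, ‖z‖ < 1) {l : ℂ} (hl : ‖l‖ < 1) {δ : ℝ}
    (hδ : 0 < δ) (h : ∀ z ∈ F, δ ≤ ‖z - l‖) :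
    ∃ g : H2, (∀ z ∈ F, g z = l / (l - z)) ∧
      ‖g‖ ≤ Real.exp ((∑ z ∈ F, (1 - ‖z‖)) / δ ^ 2) * (2 / (1 - ‖l‖)) := by
  let B : ℂ → ℂ := fun w => ∏ z ∈ F, blaschkeFactor z w
  have hB : DifferentiableOn ℂ B (Metric.ball 0 1) := by
    refine DifferentiableOn.fun_finsetProd fun z hz => ?_
    refine DifferentiableOn.div (by fun_prop) (by fun_prop) fun w hw => ?_
    exact one_sub_conj_mul_ne_zero (hF z hz) (by simpa using (mem_ball_zero_iff.1 hw).le)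
  have hB1 : ∀ w : ℂ, ‖w‖ < 1 → ‖B w‖ ≤ 1 := fun w hw => by
    rw [norm_prod]
    exact Finset.prod_le_one (fun _ _ => norm_nonneg _) fun z hz =>
      norm_blaschkeFactor_le (hF z hz) hw
  have hBl : ‖B l‖⁻¹ ≤ Real.exp ((∑ z ∈ F, (1 - ‖z‖)) / δ ^ 2) := by
    rw [norm_prod, ← Finset.prod_inv_distrib, Finset.sum_div, Real.exp_sum]
    exact Finset.prod_le_prod (fun _ _ => by positivity) fun z hz =>
      inv_norm_blaschkeFactor_le (hF z hz) hδ (h z hz)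
  have hne : ∀ z ∈ F, z - l ≠ 0 := fun z hz => norm_pos_iff.1 (hδ.trans_le (h z hz))
  have hBl0 : B l ≠ 0 := Finset.prod_ne_zero_iff.2 fun z hz =>
    div_ne_zero (hne z hz) (one_sub_conj_mul_ne_zero (hF z hz) hl.le)
  have hball : Metric.ball (0 : ℂ) 1 ∈ 𝓝 l := Metric.isOpen_ball.mem_nhds (by simpa using hl)
  -- At a zero `z` of `B` the difference quotient is `B l / (l - z)`, so the factor `l / B l`
  -- produces the prescribed value.
  obtain ⟨g, hg, hgn⟩ := H2.exists_of_norm_le (f := fun w => l / B l * dslope B l w)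
    (((Complex.differentiableOn_dslope hball).2 hB).const_mul _)
    (C := Real.exp ((∑ z ∈ F, (1 - ‖z‖)) / δ ^ 2) * (2 / (1 - ‖l‖))) fun w hw => by
      rw [norm_mul, norm_div]
      refine mul_le_mul ?_ (norm_dslope_le hB hB1 hl hw) (norm_nonneg _) (Real.exp_pos _).le
      refine le_trans ?_ hBl
      rw [← one_div]
      gcongr
  refine ⟨g, fun z hz => ?_, hgn⟩
  have hz0 : B z = 0 := Finset.prod_eq_zero hz (by simp [blaschkeFactor])
  rw [hg z (hF z hz), dslope_of_ne _ (sub_ne_zero.1 (hne z hz)), slope_def_field, hz0]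
  have h1 := hne z hz
  have h2 : l - z ≠ 0 := by rwa [← neg_sub, neg_ne_zero]
  field_simp
  ring

/-! ### Kernel sums near the unit circle and analytic continuation -/

/-- The rational function given by a finite combination of reproducing kernels. -/
def cauchySum {b : Set ℂ} (c : b →₀ ℂ) (w : ℂ) : ℂ :=
  Finsupp.linearCombination ℂ (fun z : b => (1 - conj (z : ℂ) * w)⁻¹) c

/-- A finite combination of reproducing kernels. -/
def kernelSum {b : Set ℂ} : (b →₀ ℂ) →ₗ[ℂ] H2 :=
  Finsupp.linearCombination ℂ (fun z : b => H2.kernel z)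

lemma cauchySum_sub {b : Set ℂ} (c d : b →₀ ℂ) (w : ℂ) :
    cauchySum (c - d) w = cauchySum c w - cauchySum d w := by
  simp [cauchySum]

lemma kernelSum_apply {b : Set ℂ} (hb : b ⊆ Metric.ball 0 1) (c : b →₀ ℂ) {w : ℂ} (hw : ‖w‖ < 1) :
    kernelSum c w = cauchySum c w := by
  rw [← H2.inner_kernel hw, kernelSum, cauchySum, Finsupp.linearCombination_apply,
    Finsupp.linearCombination_apply, Finsupp.sum, inner_sum]
  refine Finset.sum_congr rfl fun z _ => ?_
  rw [inner_smul_right, H2.inner_kernel hw, H2.kernel_apply (by simpa using hb z.2) hw]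
  rfl

/-- With `l = (conj w)⁻¹`, the number `l / (l - z)` is the conjugate of `1 / (1 - conj z * w)`. This
gives access to the rational function outside the disk, where the element of `H2` is zero by
convention. -/
lemma inner_kernelSum {b : Set ℂ} (hb : b ⊆ Metric.ball 0 1) (c : b →₀ ℂ) {w : ℂ} (hw : w ≠ 0)
    {g : H2} (hg : ∀ z ∈ c.support, g z = (conj w)⁻¹ / ((conj w)⁻¹ - z)) :
    ⟪g, kernelSum c⟫_ℂ = cauchySum c w := by
  rw [kernelSum, cauchySum, Finsupp.linearCombination_apply,
    Finsupp.linearCombination_apply, Finsupp.sum, inner_sum]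
  refine Finset.sum_congr rfl fun z hz => ?_
  rw [inner_smul_right, ← inner_conj_symm, H2.inner_kernel (by simpa using hb z.2), hg z hz]
  have hw' : conj w ≠ 0 := by simpa using hw
  have h2 : (conj w)⁻¹ / ((conj w)⁻¹ - (z : ℂ)) = (1 - z * conj w)⁻¹ := by
    rw [div_eq_mul_inv, ← mul_inv, mul_sub, mul_inv_cancel₀ hw', mul_comm (conj w)]
  rw [h2]
  simp

lemma sum_one_sub_norm_le {b : Set ℂ} (hb : IsInfiniteBlaschkeSet b) (F : Finset b) :
    ∑ z ∈ F.map (Function.Embedding.subtype _), (1 - ‖z‖) ≤ ∑' z : b, (1 - ‖(z : ℂ)‖) := by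
  rw [Finset.sum_map]
  refine hb.summable.sum_le_tsum F fun z _ => ?_
  exact sub_nonneg.2 (mem_ball_zero_iff.1 (hb.subset z.2)).le

/-- Pairing with the interpolant of `exists_interpolation`; the exponent is the full Blaschke sum of
`b`, so the bound does not depend on the support of `c`. -/
lemma norm_kernelSum_outside {b : Set ℂ} (hb : IsInfiniteBlaschkeSet b) (c : b →₀ ℂ) {w : ℂ}
    (hw : 1 < ‖w‖) {δ : ℝ} (hδ : 0 < δ) (h : ∀ z ∈ b, δ ≤ ‖z - (conj w)⁻¹‖) :
    ‖cauchySum c w‖ * (‖w‖ - 1) ≤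
      Real.exp ((∑' z : b, (1 - ‖(z : ℂ)‖)) / δ ^ 2) * (2 * ‖w‖) * ‖kernelSum c‖ := by
  have hw0 : 0 < ‖w‖ := by linarith
  have hl : ‖(conj w)⁻¹‖ < 1 := by
    rw [norm_inv, RCLike.norm_conj]
    exact inv_lt_one_of_one_lt₀ hw
  obtain ⟨g, hg, hgn⟩ := exists_interpolation (c.support.map (Function.Embedding.subtype _))
    (fun z hz => by
      obtain ⟨y, -, rfl⟩ := Finset.mem_map.1 hz
      exact mem_ball_zero_iff.1 (hb.subset y.2)) hl hδ
    (fun z hz => by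
      obtain ⟨y, -, rfl⟩ := Finset.mem_map.1 hz
      exact h y y.2)
  have h1 := inner_kernelSum hb.subset c (norm_pos_iff.1 hw0) (g := g) fun z hz =>
    hg z (Finset.mem_map_of_mem (Function.Embedding.subtype _) hz)
  have h2 : ‖g‖ ≤ Real.exp ((∑' z : b, (1 - ‖(z : ℂ)‖)) / δ ^ 2) * (2 / (1 - ‖(conj w)⁻¹‖)) := by
    refine hgn.trans ?_
    have := sum_one_sub_norm_le hb c.support
    have : 0 ≤ 2 / (1 - ‖(conj w)⁻¹‖) := div_nonneg zero_le_two (by linarith)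
    gcongr
  rw [← h1]
  have hw1 : 0 ≤ ‖w‖ - 1 := by linarith
  have h3 : 2 / (1 - ‖(conj w)⁻¹‖) * (‖w‖ - 1) = 2 * ‖w‖ := by
    rw [norm_inv, RCLike.norm_conj]
    have : ‖w‖ - 1 ≠ 0 := by linarith
    field_simp
  calc ‖⟪g, kernelSum c⟫_ℂ‖ * (‖w‖ - 1) ≤ (‖g‖ * ‖kernelSum c‖) * (‖w‖ - 1) := by
        gcongr
        exact norm_inner_le_norm _ _
    _ ≤ ((Real.exp ((∑' z : b, (1 - ‖(z : ℂ)‖)) / δ ^ 2) * (2 / (1 - ‖(conj w)⁻¹‖)))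
          * ‖kernelSum c‖) * (‖w‖ - 1) := by
        gcongr
    _ = _ := by rw [← h3]; ring

/-- Finite combinations of reproducing kernels are bounded, up to a factor which is singular on
the unit circle, near a boundary point that is not a limit point. -/
lemma exists_bound_off_circle {b : Set ℂ} (hb : IsInfiniteBlaschkeSet b) {p : ℂ} (hp : ‖p‖ = 1)
    {ε : ℝ} (hε : 0 < ε) (hε1 : ε ≤ 1) (h : ∀ z ∈ b, 2 * ε ≤ ‖z - p‖) :
    ∃ C : ℝ, 0 ≤ C ∧ ∀ (c : b →₀ ℂ) (w : ℂ), ‖w - p‖ ≤ ε →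
      ‖cauchySum c w‖ * |‖w‖ ^ 2 - 1| ≤ C * ‖kernelSum c‖ := by
  -- Outside the disk `2‖w‖(‖w‖ + 1) ≤ 12` because `‖w‖ ≤ 2`; inside, `1 + ‖w‖ ≤ 2`.
  refine ⟨Real.exp ((∑' z : b, (1 - ‖(z : ℂ)‖)) / ε ^ 2) * 12 + 2, by positivity,
    fun c w hw => ?_⟩
  have hE := Real.exp_pos ((∑' z : b, (1 - ‖(z : ℂ)‖)) / ε ^ 2)
  set E := Real.exp ((∑' z : b, (1 - ‖(z : ℂ)‖)) / ε ^ 2)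
  have hK := norm_nonneg (kernelSum c)
  have hEK := mul_nonneg hE.le hK
  have hw2 : ‖w‖ ≤ 2 := by
    have := norm_add_le (w - p) p
    rw [sub_add_cancel] at this
    linarith
  rcases lt_trichotomy ‖w‖ 1 with hw1 | hw1 | hw1
  · have h1 := H2.norm_apply_le hw1 (kernelSum c)
    rw [kernelSum_apply hb.subset c hw1, inv_mul_eq_div, le_div_iff₀ (by linarith)] at h1
    have h2 : |‖w‖ ^ 2 - 1| = (1 - ‖w‖) * (1 + ‖w‖) := by
      rw [abs_of_nonpos (by nlinarith [norm_nonneg w])]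
      ring
    rw [h2, ← mul_assoc]
    nlinarith [norm_nonneg w]
  · rw [hw1]
    simp only [one_pow, sub_self, abs_zero, mul_zero]
    positivity
  · have hw0 : w ≠ 0 := norm_pos_iff.1 (by linarith)
    have hp0 : p ≠ 0 := norm_pos_iff.1 (by linarith)
    have hpp : p * conj p = 1 := by
      rw [Complex.mul_conj, Complex.normSq_eq_norm_sq, hp]
      simp
    -- Reflecting an outside point in the unit circle does not increase its distance to `p`, so the
    -- reflected point stays at distance at least `ε` from `b`.
    have hlp : ‖(conj w)⁻¹ - p‖ ≤ ε := by
      have hcw : conj w ≠ 0 := by simpa using hw0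
      have : (conj w)⁻¹ - p = (conj w)⁻¹ * p * conj (p - w) := by
        rw [map_sub]
        field_simp
        linear_combination -hpp
      rw [this, norm_mul, norm_mul, norm_inv, RCLike.norm_conj, RCLike.norm_conj, hp, mul_one,
        norm_sub_rev]
      have := inv_le_one_of_one_le₀ hw1.le
      nlinarith [norm_nonneg (w - p)]
    have h1 := norm_kernelSum_outside hb c hw1 hε fun z hz => by
      have := norm_sub_le_norm_sub_add_norm_sub z (conj w)⁻¹ p
      have := h z hz
      linarith
    have h2 : |‖w‖ ^ 2 - 1| = (‖w‖ - 1) * (‖w‖ + 1) := by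
      rw [abs_of_nonneg (by nlinarith [norm_nonneg w])]
      ring
    rw [h2, ← mul_assoc]
    calc _ ≤ (E * (2 * ‖w‖) * ‖kernelSum c‖) * (‖w‖ + 1) := by gcongr
      _ = (E * ‖kernelSum c‖) * (2 * ‖w‖ * (‖w‖ + 1)) := by ring
      _ ≤ (E * ‖kernelSum c‖) * 12 := by
        gcongr
        nlinarith [norm_nonneg w]
      _ ≤ _ := by nlinarith

/-- A pole `w` would be the reflection of `z`, for which `‖z - p‖ = ‖z‖ * ‖w - p‖ ≤ ‖w - p‖`. -/
lemma one_sub_conj_mul_ne_zero_of_near {p w z : ℂ} (hp : ‖p‖ = 1) (hz : ‖z‖ < 1)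
    (h : ‖w - p‖ < ‖z - p‖) : 1 - conj z * w ≠ 0 := by
  intro h0
  have hpp : p * conj p = 1 := by
    rw [Complex.mul_conj, Complex.normSq_eq_norm_sq, hp]
    simp
  have h1 : z * conj w = 1 := by
    have := congrArg conj (sub_eq_zero.1 h0)
    simpa using this.symm
  have h2 : z - p = - (z * p) * conj (w - p) := by
    rw [map_sub]
    linear_combination p * h1 - z * hpp
  have h3 : ‖z - p‖ = ‖z‖ * ‖w - p‖ := by
    rw [h2, norm_mul, norm_neg, norm_mul, hp, RCLike.norm_conj, mul_one]
  nlinarith [norm_nonneg (w - p), norm_nonneg z]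

lemma differentiableOn_cauchySum {b : Set ℂ} (hb : b ⊆ Metric.ball 0 1) {p : ℂ} (hp : ‖p‖ = 1)
    {ε : ℝ} (hε : 0 < ε) (h : ∀ z ∈ b, 2 * ε ≤ ‖z - p‖) (c : b →₀ ℂ) :
    DifferentiableOn ℂ (cauchySum c) (Metric.closedBall p ε) := by
  unfold cauchySum
  simp only [Finsupp.linearCombination_apply, Finsupp.sum]
  refine DifferentiableOn.fun_sum fun z _ => DifferentiableOn.fun_const_smul ?_ _
  refine DifferentiableOn.inv (by fun_prop) fun w hw => ?_
  refine one_sub_conj_mul_ne_zero_of_near hp (mem_ball_zero_iff.1 (hb z.2)) ?_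
  have := h z z.2
  rw [mem_closedBall_iff_norm] at hw
  linarith

/-- The singular factor of `exists_bound_off_circle` is cancelled on a circle about `p` by an
analytic multiplier; the maximum principle then carries the bound inside. -/
lemma exists_uniform_bound {b : Set ℂ} (hb : IsInfiniteBlaschkeSet b) {p : ℂ} (hp : ‖p‖ = 1)
    {ε : ℝ} (hε : 0 < ε) (hε1 : ε ≤ 1) (h : ∀ z ∈ b, 2 * ε ≤ ‖z - p‖) :
    ∃ C : ℝ, 0 ≤ C ∧ ∀ (c : b →₀ ℂ) (w : ℂ), ‖w - p‖ ≤ ε / 4 →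
      ‖cauchySum c w‖ ≤ C * ‖kernelSum c‖ := by
  obtain ⟨C, hC, hbd⟩ := exists_bound_off_circle hb hp hε hε1 h
  have hpp : p * conj p = 1 := by
    rw [Complex.mul_conj, Complex.normSq_eq_norm_sq, hp]
    simp
  refine ⟨C * ε / (ε ^ 2 / 2), by positivity, fun c w hw => ?_⟩
  -- With `v = w * conj p - 1` and `v * conj v = ε²` on the sphere, `q w = v * (|v + 1|² - 1)`, so
  -- the modulus of the polynomial is exactly `ε * |‖w‖² - 1|` there.
  let q : ℂ → ℂ := fun w => (w * conj p - 1) ^ 2 + ε ^ 2 * (w * conj p)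
  have hu : ∀ w : ℂ, ‖w * conj p - 1‖ = ‖w - p‖ := fun w => by
    have : w * conj p - 1 = (w - p) * conj p := by linear_combination hpp
    rw [this, norm_mul, RCLike.norm_conj, hp, mul_one]
  have hun : ∀ w : ℂ, ‖w * conj p‖ = ‖w‖ := fun w => by
    rw [norm_mul, RCLike.norm_conj, hp, mul_one]
  have hq : ∀ w ∈ Metric.sphere p ε, ‖q w‖ = ε * |‖w‖ ^ 2 - 1| := by
    intro w hw
    rw [mem_sphere_iff_norm, ← hu] at hw
    set v := w * conj p - 1 with hv
    have hvv : (ε : ℂ) ^ 2 = v * conj v := by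
      rw [Complex.mul_conj, Complex.normSq_eq_norm_sq, hw]
      simp
    have hww : ((‖w‖ ^ 2 : ℝ) : ℂ) = (v + 1) * conj (v + 1) := by
      rw [Complex.mul_conj, Complex.normSq_eq_norm_sq, hv, sub_add_cancel, hun]
    have : q w = v * ((‖w‖ ^ 2 - 1 : ℝ) : ℂ) := by
      have h1 : w * conj p = v + 1 := by rw [hv, sub_add_cancel]
      simp only [q]
      rw [Complex.ofReal_sub, hww, h1, hvv, map_add, map_one, Complex.ofReal_one]
      ring
    rw [this, norm_mul, hw, Complex.norm_real, Real.norm_eq_abs]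
  have hmax : ‖q w * cauchySum c w‖ ≤ C * ε * ‖kernelSum c‖ := by
    refine Complex.norm_le_of_forall_mem_frontier_norm_le (U := Metric.ball p ε)
      (f := fun w => q w * cauchySum c w) Metric.isBounded_ball ?_ ?_ ?_
    · refine DifferentiableOn.diffContOnCl ?_
      rw [closure_ball p hε.ne']
      exact DifferentiableOn.mul (by fun_prop) (differentiableOn_cauchySum hb.subset hp hε h c)
    · rw [frontier_ball p hε.ne']
      intro z hz
      rw [norm_mul, hq z hz]
      have := hbd c z (mem_sphere_iff_norm.1 hz).le
      nlinarith
    · rw [closure_ball p hε.ne', mem_closedBall_iff_norm]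
      linarith
  -- On the smaller disk `‖w‖ ≥ 3/4` and `‖w - p‖² ≤ ε²/16`, so the term `ε² * (w * conj p)`
  -- dominates.
  have hlow : ε ^ 2 / 2 ≤ ‖q w‖ := by
    have h1 := norm_sub_le_norm_add ((ε : ℂ) ^ 2 * (w * conj p)) ((w * conj p - 1) ^ 2)
    rw [add_comm, norm_mul, norm_pow, norm_pow, hun, hu, Complex.norm_real,
      Real.norm_of_nonneg hε.le] at h1
    have h2 : 3 / 4 ≤ ‖w‖ := by
      have := norm_sub_norm_le p w
      rw [norm_sub_rev] at this
      linarith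
    have h3 : ‖w - p‖ ^ 2 ≤ (ε / 4) ^ 2 := pow_le_pow_left₀ (norm_nonneg _) hw 2
    nlinarith [sq_nonneg ε]
  rw [norm_mul] at hmax
  rw [div_mul_eq_mul_div, le_div_iff₀ (by positivity)]
  nlinarith [norm_nonneg (cauchySum c w)]

/-- Functions orthogonal to `Z_b` extend analytically across the points of the unit circle that
are not limit points of `b`. -/
lemma exists_analytic_extension {b : Set ℂ} (hb : IsInfiniteBlaschkeSet b) {p : ℂ}
    (hp : ‖p‖ = 1) (hpb : p ∉ closure b) {f : H2} (hf : f ∈ (zeroSpace b)ᗮ) :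
    ∃ r > 0, ∃ F : ℂ → ℂ, DifferentiableOn ℂ F (Metric.ball p r) ∧
      ∀ w ∈ Metric.ball p r, ‖w‖ < 1 → F w = f w := by
  obtain ⟨d, hd, hdb⟩ : ∃ d > 0, ∀ z ∈ b, d ≤ ‖z - p‖ := by
    rw [Metric.mem_closure_iff] at hpb
    push Not at hpb
    obtain ⟨d, hd, h⟩ := hpb
    exact ⟨d, hd, fun z hz => by rw [← dist_eq_norm, dist_comm]; exact h z hz⟩
  set ε := min (d / 2) 1
  have hε : 0 < ε := lt_min (by linarith) one_pos
  have hεb : ∀ z ∈ b, 2 * ε ≤ ‖z - p‖ := fun z hz => by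
    have := min_le_left (d / 2) 1
    have := hdb z hz
    linarith
  obtain ⟨C, hC, hbd⟩ := exists_uniform_bound hb hp hε (min_le_right _ _) hεb
  rw [zeroSpace_orthogonal hb.subset, ← SetLike.mem_coe, Submodule.topologicalClosure_coe,
    mem_closure_iff_seq_limit] at hf
  obtain ⟨u, hu, hlim⟩ := hf
  have hc : ∀ n, ∃ c : b →₀ ℂ, kernelSum c = u n := fun n => by
    have := hu n
    rwa [SetLike.mem_coe, ← Finsupp.range_linearCombination] at this
  choose c hc using hc
  obtain rfl : (fun n => kernelSum (c n)) = u := funext hc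
  -- The uniform bound is applied to differences of kernel sums, by linearity.
  have hcs : UniformCauchySeqOn (fun n => cauchySum (c n)) atTop (Metric.ball p (ε / 4)) := by
    rw [Metric.uniformCauchySeqOn_iff]
    intro η hη
    obtain ⟨N, hN⟩ := Metric.cauchySeq_iff.1 hlim.cauchySeq (η / (C + 1)) (by positivity)
    refine ⟨N, fun m hm n hn w hw => ?_⟩
    have h1 := hbd (c m - c n) w (mem_ball_iff_norm.1 hw).le
    have h2 := hN m hm n hn
    rw [dist_eq_norm, ← map_sub, lt_div_iff₀ (by positivity)] at h2
    rw [cauchySum_sub] at h1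
    rw [dist_eq_norm]
    nlinarith [norm_nonneg (kernelSum (c m - c n))]
  have hex : ∀ w, ∃ l, w ∈ Metric.ball p (ε / 4) →
      Tendsto (fun n => cauchySum (c n) w) atTop (𝓝 l) := fun w => by
    by_cases hw : w ∈ Metric.ball p (ε / 4)
    · obtain ⟨l, hl⟩ := cauchySeq_tendsto_of_complete (hcs.cauchySeq hw)
      exact ⟨l, fun _ => hl⟩
    · exact ⟨0, fun h => absurd h hw⟩
  choose F hF using hex
  refine ⟨ε / 4, by positivity, F, ?_, fun w hw hw1 => ?_⟩
  · refine (hcs.tendstoUniformlyOn_of_tendsto fun w hw => hF w hw).tendstoLocallyUniformlyOn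
      |>.differentiableOn (Eventually.of_forall fun n => ?_) Metric.isOpen_ball
    exact (differentiableOn_cauchySum hb.subset hp hε hεb (c n)).mono
      ((Metric.ball_subset_ball (by linarith)).trans Metric.ball_subset_closedBall)
  · refine tendsto_nhds_unique (hF w hw) ?_
    have h1 : Tendsto (fun n => ⟪H2.kernel w, kernelSum (c n)⟫_ℂ) atTop (𝓝 ⟪H2.kernel w, f⟫_ℂ) :=
      tendsto_const_nhds.inner hlim
    rw [H2.inner_kernel hw1] at h1
    refine h1.congr fun n => ?_
    rw [H2.inner_kernel hw1, kernelSum_apply hb.subset _ hw1]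

/-! ### Triviality of the intersections -/

/-- A Blaschke set has no limit points inside the disk. -/
lemma norm_eq_one_of_mem_limitSet {a : Set ℂ} (ha : IsInfiniteBlaschkeSet a) {p : ℂ}
    (hp : p ∈ limitSet a) : ‖p‖ = 1 := by
  have h1 : p ∈ Metric.closedBall (0 : ℂ) 1 :=
    closure_minimal (ha.subset.trans Metric.ball_subset_closedBall) Metric.isClosed_closedBall hp.1
  rw [mem_closedBall_zero_iff] at h1
  refine h1.antisymm (not_lt.1 fun hlt => ?_)
  have hacc : AccPt p (𝓟 a) := by
    rw [accPt_iff_frequently]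
    refine (mem_closure_iff_frequently.1 hp.1).mono fun y hy => ⟨?_, hy⟩
    rintro rfl
    exact hp.2 hy
  set s := (1 - ‖p‖) / 2
  have hs : 0 < s := by simp only [s]; linarith
  have hfin := ha.summable.tendsto_cofinite_zero.eventually_lt_const hs
  rw [Filter.eventually_cofinite] at hfin
  -- Near `p` the terms `1 - ‖z‖` exceed `s`, which summability allows only finitely often.
  have hfin2 : (Metric.ball p s ∩ a).Finite := by
    refine (hfin.image Subtype.val).subset ?_
    rintro z ⟨hz, hza⟩
    refine ⟨⟨z, hza⟩, ?_, rfl⟩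
    simp only [mem_ofPred_eq, not_lt]
    rw [mem_ball_iff_norm] at hz
    have := norm_sub_norm_le z p
    simp only [s] at hz ⊢
    linarith
  exact Set.Infinite.of_accPt (hacc.nhds_inter (Metric.ball_mem_nhds p hs)) hfin2

/-- At a point `p ∈ lim a \ lim b` the function continues analytically and its zeros in `a`
accumulate. The identity theorem is used twice: for the continuation near `p`, then for `f` on the
disk. -/
theorem zeroSpace_inf_orthogonal_eq_bot {a b : Set ℂ} (ha : IsInfiniteBlaschkeSet a)
    (hb : IsInfiniteBlaschkeSet b) (h : ¬ limitSet a ⊆ limitSet b) :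
    zeroSpace a ⊓ (zeroSpace b)ᗮ = ⊥ := by
  obtain ⟨p, hpa, hpb⟩ := not_subset.1 h
  have hp := norm_eq_one_of_mem_limitSet ha hpa
  have hpb' : p ∉ closure b := fun hc => hpb ⟨hc, fun hb' => by
    have := mem_ball_zero_iff.1 (hb.subset hb')
    linarith⟩
  rw [eq_bot_iff]
  rintro f ⟨hfa, hfb⟩
  obtain ⟨r, hr, F, hF, hFf⟩ := exists_analytic_extension hb hp hpb' hfb
  have hF0 : EqOn F 0 (Metric.ball p r) := by
    refine (hF.analyticOnNhd Metric.isOpen_ball).eqOn_zero_of_preconnected_of_frequently_eq_zero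
      (convex_ball p r).isPreconnected (Metric.mem_ball_self hr) ?_
    have hfr : ∃ᶠ z in 𝓝[≠] p, z ∈ a := by
      rw [frequently_nhdsWithin_iff]
      refine (mem_closure_iff_frequently.1 hpa.1).mono fun y hy => ⟨hy, ?_⟩
      rintro rfl
      exact hpa.2 hy
    refine (hfr.and_eventually (nhdsWithin_le_nhds (Metric.ball_mem_nhds p hr))).mono ?_
    rintro z ⟨hza, hzb⟩
    rw [hFf z hzb (mem_ball_zero_iff.1 (ha.subset hza))]
    exact hfa z hza
  have hne : (Metric.ball p r ∩ Metric.ball 0 1).Nonempty := by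
    have : p ∈ closure (Metric.ball (0 : ℂ) 1) := by
      rw [closure_ball _ one_ne_zero, mem_closedBall_zero_iff, hp]
    exact mem_closure_iff.1 this _ Metric.isOpen_ball (Metric.mem_ball_self hr)
  obtain ⟨q, hq⟩ := hne
  have hf0 : EqOn f 0 (Metric.ball 0 1) := by
    refine (f.isHardy.analytic.analyticOnNhd
      Metric.isOpen_ball).eqOn_zero_of_preconnected_of_eventuallyEq_zero
      (convex_ball 0 1).isPreconnected hq.2 ?_
    filter_upwards [(Metric.isOpen_ball.inter Metric.isOpen_ball).mem_nhds hq] with z hz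
    rw [← hFf z hz.1 (mem_ball_zero_iff.1 hz.2)]
    exact hF0 hz.1
  refine (Submodule.mem_bot ℂ).2 (H2.toFun_injective (funext fun z => ?_))
  by_cases hz : ‖z‖ < 1
  · exact hf0 (mem_ball_zero_iff.2 hz)
  · exact f.isHardy.zero_off z (not_lt.1 hz)

end Hardy

/-! ### Reflections, functional calculus and the exponent -/

namespace Grassmann

open scoped InnerProductSpace

variable {H : Type*} [NormedAddCommGroup H] [InnerProductSpace ℂ H]

lemma eq_of_mul_eq_of_denseRange {B S T : H →L[ℂ] H} (hB : DenseRange B) (h : S * B = T * B) :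
    S = T := by
  refine ContinuousLinearMap.ext fun x => ?_
  refine congrFun (hB.equalizer S.continuous T.continuous (funext fun y => ?_)) x
  exact congrArg (fun U : H →L[ℂ] H => U y) h

lemma eq_of_mul_eq_of_injective {B S T : H →L[ℂ] H} (hB : Function.Injective B)
    (h : B * S = B * T) : S = T :=
  ContinuousLinearMap.ext fun x => hB (congrArg (fun U : H →L[ℂ] H => U x) h)

variable [CompleteSpace H]

lemma norm_le_one_of_star_mul_self_eq_one {U : H →L[ℂ] H} (h : star U * U = 1) : ‖U‖ ≤ 1 := by
  have h1 := CStarRing.norm_star_mul_self (x := U)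
  rw [h] at h1
  have h2 : ‖(1 : H →L[ℂ] H)‖ ≤ 1 := ContinuousLinearMap.norm_id_le
  nlinarith [norm_nonneg U]

lemma abs_le_norm_of_mem_spectrum {X : H →L[ℂ] H} {x : ℝ} (hx : x ∈ spectrum ℝ X) :
    |x| ≤ ‖X‖ := by
  rcases subsingleton_or_nontrivial H with h | h
  · have : Subsingleton (H →L[ℂ] H) := inferInstance
    rw [spectrum.of_subsingleton] at hx
    exact hx.elim
  · exact spectrum.norm_le_norm_of_mem (𝕜 := ℝ) hx

/-- Euler's formula on the spectrum, after rewriting the real functional calculus as a complex one.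
-/
lemma exp_I_smul_eq {X : H →L[ℂ] H} (hX : IsSelfAdjoint X) :
    NormedSpace.exp (Complex.I • X) = cfc Real.cos X + Complex.I • cfc Real.sin X := by
  have hXn : IsStarNormal X := hX.isStarNormal
  have hIX : IsStarNormal (Complex.I • X) := by
    constructor
    rw [star_smul, hX.star_eq]
    exact ((Commute.refl X).smul_left _).smul_right _
  rw [← CFC.exp_eq_normedSpace_exp (𝕜 := ℂ) hIX, ← cfc_comp_smul Complex.I _ X,
    cfc_real_eq_complex _ hX, cfc_real_eq_complex _ hX,
    ← cfc_smul Complex.I _ X, ← cfc_add (a := X) (fun z => ((Real.cos z.re : ℝ) : ℂ))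
      (fun z => Complex.I • ((Real.sin z.re : ℝ) : ℂ))]
  refine cfc_congr fun z hz => ?_
  have hz : z = (z.re : ℂ) := hX.mem_spectrum_eq_re hz
  rw [← Complex.exp_eq_exp_ℂ, smul_eq_mul, smul_eq_mul, hz, mul_comm, Complex.exp_mul_I]
  simp [mul_comm]

/-- Conjugation by `R` is a continuous star automorphism sending `X` to `-X`, and such maps commute
with the functional calculus. -/
lemma cfc_conj_reflection {R X : H →L[ℂ] H} (hR : IsSelfAdjoint R) (hR2 : R * R = 1)
    (hX : IsSelfAdjoint X) (h : R * X = -(X * R)) {f : ℝ → ℝ} (hf : Continuous f) :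
    R * cfc f X * R = cfc (fun x => f (-x)) X := by
  have hu : R ∈ unitary (H →L[ℂ] H) := by
    rw [Unitary.mem_iff, hR.star_eq]
    exact ⟨hR2, hR2⟩
  let conjR := Unitary.conjStarAlgAut ℂ (H →L[ℂ] H) ⟨R, hu⟩
  have hconjR : ∀ T, conjR T = R * T * R := fun T => by
    simp [conjR, Unitary.conjStarAlgAut_apply, hR.star_eq]
  have hconjRX : conjR X = -X := by rw [hconjR, h, neg_mul, mul_assoc, hR2, mul_one]
  have hconjRc : Continuous conjR := by
    have : (conjR : (H →L[ℂ] H) → (H →L[ℂ] H)) = fun T => R * T * R := funext hconjR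
    rw [this]
    fun_prop
  rw [← hconjR, StarAlgHomClass.map_cfc (S := ℂ) conjR f X hf.continuousOn hconjRc hX (by rw [hconjRX]; exact hX.neg), hconjRX,
    cfc_comp_neg f X hf.continuousOn hX]

lemma commute_cfc_of_even {R X : H →L[ℂ] H} (hR : IsSelfAdjoint R) (hR2 : R * R = 1)
    (hX : IsSelfAdjoint X) (h : R * X = -(X * R)) {f : ℝ → ℝ} (hf : Continuous f)
    (he : ∀ x, f (-x) = f x) : R * cfc f X = cfc f X * R := by
  have := cfc_conj_reflection hR hR2 hX h hf
  simp only [he] at this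
  calc R * cfc f X = R * cfc f X * R * R := by rw [mul_assoc _ R R, hR2, mul_one]
    _ = _ := by rw [this]

lemma anticommute_cfc_of_odd {R X : H →L[ℂ] H} (hR : IsSelfAdjoint R) (hR2 : R * R = 1)
    (hX : IsSelfAdjoint X) (h : R * X = -(X * R)) {f : ℝ → ℝ} (hf : Continuous f)
    (he : ∀ x, f (-x) = - f x) : R * cfc f X = -(cfc f X * R) := by
  have := cfc_conj_reflection hR hR2 hX h hf
  simp only [he, cfc_neg] at this
  calc R * cfc f X = R * cfc f X * R * R := by rw [mul_assoc _ R R, hR2, mul_one]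
    _ = _ := by rw [this, neg_mul]

lemma cfc_sin_sq_add_cfc_cos_sq {X : H →L[ℂ] H} (hX : IsSelfAdjoint X) :
    cfc Real.sin X * cfc Real.sin X + cfc Real.cos X * cfc Real.cos X = 1 := by
  rw [← cfc_mul _ _ X, ← cfc_mul _ _ X,
    ← cfc_add (a := X) (fun x => Real.sin x * Real.sin x) (fun x => Real.cos x * Real.cos x)]
  simp only [← sq, Real.sin_sq_add_cos_sq]
  exact cfc_const_one ℝ X

lemma cfc_arcsin_cfc_sin {X : H →L[ℂ] H} (hX : IsSelfAdjoint X) (hn : ‖X‖ ≤ Real.pi / 2) :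
    cfc Real.arcsin (cfc Real.sin X) = X := by
  rw [← cfc_comp Real.arcsin Real.sin X hX Real.continuous_arcsin.continuousOn
    Real.continuous_sin.continuousOn]
  conv_rhs => rw [← cfc_id ℝ X]
  refine cfc_congr fun x hx => ?_
  have := abs_le.1 ((abs_le_norm_of_mem_spectrum hx).trans hn)
  exact Real.arcsin_sin (by linarith [this.1]) this.2

lemma cfc_cos_nonneg {X : H →L[ℂ] H} (hn : ‖X‖ ≤ Real.pi / 2) : 0 ≤ cfc Real.cos X := by
  refine cfc_nonneg fun x hx => ?_
  have := abs_le.1 ((abs_le_norm_of_mem_spectrum hx).trans hn)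
  exact Real.cos_nonneg_of_neg_pi_div_two_le_of_le (by linarith [this.1]) this.2

lemma denseRange_of_selfAdjoint_injective {B : H →L[ℂ] H} (hB : IsSelfAdjoint B)
    (h : Function.Injective B) : DenseRange B := by
  have h1 : B.rangeᗮ = ⊥ := by
    rw [ContinuousLinearMap.orthogonal_range, ← ContinuousLinearMap.star_eq_adjoint, hB.star_eq]
    exact LinearMap.ker_eq_bot.2 h
  exact (Submodule.dense_iff_topologicalClosure_eq_top).2
    (Submodule.topologicalClosure_eq_top_iff.2 h1)

lemma isSelfAdjoint_abs (A : H →L[ℂ] H) : IsSelfAdjoint (CFC.abs A) :=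
  IsSelfAdjoint.of_nonneg (CFC.abs_nonneg A)

lemma norm_abs_apply (A : H →L[ℂ] H) (x : H) : ‖CFC.abs A x‖ = ‖A x‖ := by
  have h1 : ∀ T : H →L[ℂ] H, ‖T x‖ ^ 2 = RCLike.re ⟪x, (star T * T) x⟫_ℂ := fun T => by
    rw [ContinuousLinearMap.star_eq_adjoint, mul_apply_eq_comp,
      ContinuousLinearMap.adjoint_inner_right, inner_self_eq_norm_sq]
  have h2 : ‖CFC.abs A x‖ ^ 2 = ‖A x‖ ^ 2 := by
    rw [h1, h1, (isSelfAdjoint_abs A).star_eq, CFC.abs_mul_abs]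
  exact (sq_eq_sq₀ (norm_nonneg _) (norm_nonneg _)).1 h2

lemma injective_abs {A : H →L[ℂ] H} (h : Function.Injective A) :
    Function.Injective (CFC.abs A : H →L[ℂ] H) := by
  refine (injective_iff_map_eq_zero _).2 fun x hx => ?_
  refine (injective_iff_map_eq_zero A).1 h x ?_
  rw [← norm_eq_zero, ← norm_abs_apply, hx, norm_zero]

/-- The sign of an injective self-adjoint operator. -/
lemma exists_sign {A : H →L[ℂ] H} (hA : IsSelfAdjoint A) (h : Function.Injective A) :
    ∃ W : H →L[ℂ] H, IsSelfAdjoint W ∧ W * W = 1 ∧ W * CFC.abs A = A ∧ Commute W (CFC.abs A) := by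
  have hBs := isSelfAdjoint_abs A
  have hBi := injective_abs h
  have hBd := denseRange_of_selfAdjoint_injective hBs hBi
  have hAB : CFC.abs A * A = A * CFC.abs A := (CFC.commute_abs_self A hA.isStarNormal).eq
  have hBB : CFC.abs A * CFC.abs A = A * A := by rw [CFC.abs_mul_abs, hA.star_eq]
  -- The isometric map `|A| x ↦ A x`, extended from the dense range of `|A|`.
  let W : H →L[ℂ] H := A.toLinearMap.extendOfNorm (CFC.abs A : H →L[ℂ] H).toLinearMap
  have hW : W * CFC.abs A = A := by
    refine ContinuousLinearMap.ext fun x => ?_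
    exact LinearMap.extendOfNorm_eq hBd
      ⟨1, fun x => by rw [one_mul]; exact (norm_abs_apply A x).ge⟩ x
  have hc : W * CFC.abs A = CFC.abs A * W := by
    refine eq_of_mul_eq_of_denseRange hBd ?_
    rw [hW, mul_assoc, hW, hAB]
  have hs : star W = W := by
    refine eq_of_mul_eq_of_injective hBi ?_
    rw [← hc, hW]
    have := congrArg star hW
    rwa [star_mul, hBs.star_eq, hA.star_eq] at this
  refine ⟨W, hs, ?_, hW, hc⟩
  refine eq_of_mul_eq_of_denseRange hBd (eq_of_mul_eq_of_injective hBi ?_)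
  rw [one_mul, hBB, mul_assoc W W, hW, ← mul_assoc, ← hc, hW]

lemma cos_add_sin_mul_cos_sub_sin {X : H →L[ℂ] H} (hX : IsSelfAdjoint X) :
    (cfc Real.cos X + Complex.I • cfc Real.sin X) * (cfc Real.cos X - Complex.I • cfc Real.sin X)
      = 1 := by
  have hCS : cfc Real.cos X * cfc Real.sin X = cfc Real.sin X * cfc Real.cos X :=
    (cfc_commute_cfc _ _ _).eq
  rw [← cfc_sin_sq_add_cfc_cos_sq hX]
  simp only [mul_sub, add_mul, smul_mul_assoc, mul_smul_comm, smul_add, smul_smul,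
    Complex.I_mul_I, hCS]
  simp only [neg_smul, one_smul]
  abel

lemma cos_sub_sin_mul_cos_add_sin {X : H →L[ℂ] H} (hX : IsSelfAdjoint X) :
    (cfc Real.cos X - Complex.I • cfc Real.sin X) * (cfc Real.cos X + Complex.I • cfc Real.sin X)
      = 1 := by
  have hCS : cfc Real.cos X * cfc Real.sin X = cfc Real.sin X * cfc Real.cos X :=
    (cfc_commute_cfc _ _ _).eq
  rw [← cfc_sin_sq_add_cfc_cos_sq hX]
  simp only [mul_add, sub_mul, smul_mul_assoc, mul_smul_comm, smul_sub, smul_smul,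
    Complex.I_mul_I, hCS]
  simp only [neg_smul, one_smul]
  abel

lemma reflection_mul_cos_sub_sin {R X : H →L[ℂ] H} (hR : IsSelfAdjoint R) (hR2 : R * R = 1)
    (hX : IsSelfAdjoint X) (h : R * X = -(X * R)) :
    R * (cfc Real.cos X - Complex.I • cfc Real.sin X) =
      (cfc Real.cos X + Complex.I • cfc Real.sin X) * R := by
  rw [mul_sub, add_mul, mul_smul_comm, smul_mul_assoc,
    commute_cfc_of_even hR hR2 hX h Real.continuous_cos Real.cos_neg,
    anticommute_cfc_of_odd hR hR2 hX h Real.continuous_sin Real.sin_neg, smul_neg, sub_neg_eq_add]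

lemma star_cos_add_sin (X : H →L[ℂ] H) :
    star (cfc Real.cos X + Complex.I • cfc Real.sin X) =
      cfc Real.cos X - Complex.I • cfc Real.sin X := by
  have hC : IsSelfAdjoint (cfc Real.cos X) := cfc_predicate _ _
  have hS : IsSelfAdjoint (cfc Real.sin X) := cfc_predicate _ _
  rw [star_add, star_smul, hC.star_eq, hS.star_eq]
  simp [sub_eq_add_neg]

/-- The unitary `exp (i X)` attached to an operator `X` which is co-diagonal with respect to two
reflections and which exchanges them is determined by the reflections. -/
lemma exp_mul_abs_eq {R R' X : H →L[ℂ] H} (hR : IsSelfAdjoint R) (hR2 : R * R = 1)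
    (hX : IsSelfAdjoint X) (hn : ‖X‖ ≤ Real.pi / 2) (h : R * X = -(X * R))
    (hexp : NormedSpace.exp (Complex.I • X) * R = R' * NormedSpace.exp (Complex.I • X)) :
    NormedSpace.exp (Complex.I • X) * R * CFC.abs (R + R') = R + R' := by
  have hC : IsSelfAdjoint (cfc Real.cos X) := cfc_predicate _ _
  have hS : IsSelfAdjoint (cfc Real.sin X) := cfc_predicate _ _
  have hCR := commute_cfc_of_even hR hR2 hX h Real.continuous_cos Real.cos_neg
  have hVV := cos_add_sin_mul_cos_sub_sin hX
  have hVV' := cos_sub_sin_mul_cos_add_sin hX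
  have hVR := reflection_mul_cos_sub_sin hR hR2 hX h
  have hC0 := cfc_cos_nonneg hn
  rw [exp_I_smul_eq hX] at hexp ⊢
  set C := cfc Real.cos X
  set S := cfc Real.sin X
  -- Write `V = exp (iX)`. Since `R V⁻¹ = V R`, the relation `R' = V R V⁻¹` becomes `R' = V² R`.
  have hR'eq : R' = (C + Complex.I • S) * ((C + Complex.I • S) * R) := by
    rw [← hVR, ← mul_assoc, hexp, mul_assoc, hVV, mul_one]
  have hA : R + R' = (C + Complex.I • S) * R * (C + C) := by
    calc R + R' = (C + Complex.I • S) * ((C - Complex.I • S) * R)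
          + (C + Complex.I • S) * ((C + Complex.I • S) * R) := by
          rw [← hR'eq, ← mul_assoc, hVV, one_mul]
      _ = (C + Complex.I • S) * (C * R + C * R) := by
          rw [← mul_add, ← add_mul]
          congr 1
          rw [← add_mul]
          congr 1
          abel
      _ = _ := by rw [← hCR, ← mul_add, mul_assoc]
  -- `V R` is unitary and `cos X ≥ 0`, so `2 cos X` is the positive factor of the polar
  -- decomposition.
  have habs : CFC.abs (R + R') = C + C := by
    refine CFC.sqrt_unique ?_ (add_nonneg hC0 hC0)
    have hsa : star (R + R') = (C + C) * R * (C - Complex.I • S) := by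
      rw [hA]
      simp only [star_mul, star_add, star_smul, hC.star_eq, hS.star_eq, hR.star_eq, mul_assoc]
      congr 2
      simp [sub_eq_add_neg]
    rw [hsa, hA]
    calc (C + C) * (C + C) = (C + C) * (R * R) * (C + C) := by rw [hR2, mul_one]
      _ = (C + C) * (R * ((C - Complex.I • S) * (C + Complex.I • S)) * R) * (C + C) := by
        rw [hVV', mul_one]
      _ = _ := by simp only [mul_assoc]
  rw [habs, ← hA]

/-- The sine of an exponent is bounded by the distance of the reflections that it exchanges. -/
lemma two_mul_norm_cfc_sin_le {R R' X : H →L[ℂ] H} (hR : IsSelfAdjoint R) (hR2 : R * R = 1)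
    (hX : IsSelfAdjoint X) (h : R * X = -(X * R))
    (hexp : NormedSpace.exp (Complex.I • X) * R = R' * NormedSpace.exp (Complex.I • X)) :
    2 * ‖cfc Real.sin X‖ ≤ ‖R - R'‖ := by
  have hVV := cos_add_sin_mul_cos_sub_sin hX
  have hVV' := cos_sub_sin_mul_cos_add_sin hX
  have hVR := reflection_mul_cos_sub_sin hR hR2 hX h
  have hVs := star_cos_add_sin X
  rw [exp_I_smul_eq hX] at hexp
  set V := cfc Real.cos X + Complex.I • cfc Real.sin X with hV
  set V' := cfc Real.cos X - Complex.I • cfc Real.sin X with hV'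
  have hR'eq : R' = V * (V * R) := by
    rw [← hVR, ← mul_assoc, hexp, mul_assoc, hVV, mul_one]
  -- Since `R' = V² R`, the left side equals `V⁻¹ - V`.
  have e : V' * (R - R') * R = (-2 * Complex.I) • cfc Real.sin X := by
    rw [hR'eq, mul_sub, ← mul_assoc V', hVV', one_mul, ← sub_mul, mul_assoc, hR2, mul_one, hV, hV']
    module
  have hn : ‖V'‖ ≤ 1 := norm_le_one_of_star_mul_self_eq_one (by rw [← hVs, star_star, hVs, hVV])
  have hRn : ‖R‖ ≤ 1 := norm_le_one_of_star_mul_self_eq_one (by rw [hR.star_eq, hR2])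
  have h1 : ‖V' * (R - R') * R‖ = 2 * ‖cfc Real.sin X‖ := by
    rw [e, norm_smul]
    simp
  rw [← h1]
  calc ‖V' * (R - R') * R‖ ≤ ‖V'‖ * ‖R - R'‖ * ‖R‖ :=
        (norm_mul_le _ _).trans (by gcongr; exact norm_mul_le _ _)
    _ ≤ 1 * ‖R - R'‖ * 1 := by gcongr
    _ = _ := by rw [one_mul, mul_one]

/-- By `exp_mul_abs_eq` both exponentials agree on the dense range of `|R + R'|`; the exponent is
recovered as the arcsine of the imaginary part. -/
lemma exponent_unique {R R' X Y : H →L[ℂ] H} (hR : IsSelfAdjoint R) (hR2 : R * R = 1)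
    (hinj : Function.Injective (R + R'))
    (hX : IsSelfAdjoint X) (hXn : ‖X‖ ≤ Real.pi / 2) (hXR : R * X = -(X * R))
    (hXe : NormedSpace.exp (Complex.I • X) * R = R' * NormedSpace.exp (Complex.I • X))
    (hY : IsSelfAdjoint Y) (hYn : ‖Y‖ ≤ Real.pi / 2) (hYR : R * Y = -(Y * R))
    (hYe : NormedSpace.exp (Complex.I • Y) * R = R' * NormedSpace.exp (Complex.I • Y)) :
    X = Y := by
  have hd := denseRange_of_selfAdjoint_injective (isSelfAdjoint_abs (R + R')) (injective_abs hinj)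
  have h1 : NormedSpace.exp (Complex.I • X) * R = NormedSpace.exp (Complex.I • Y) * R :=
    eq_of_mul_eq_of_denseRange hd ((exp_mul_abs_eq hR hR2 hX hXn hXR hXe).trans
      (exp_mul_abs_eq hR hR2 hY hYn hYR hYe).symm)
  have h2 : NormedSpace.exp (Complex.I • X) = NormedSpace.exp (Complex.I • Y) := by
    have := congrArg (· * R) h1
    simpa only [mul_assoc, hR2, mul_one] using this
  rw [exp_I_smul_eq hX, exp_I_smul_eq hY] at h2
  have h3 := congrArg star h2
  have sa : ∀ (f : ℝ → ℝ) (Z : H →L[ℂ] H), star (cfc f Z) = cfc f Z := fun f Z =>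
    (cfc_predicate f Z : IsSelfAdjoint _)
  simp only [star_add, star_smul, sa] at h3
  have h4 : (2 * Complex.I) • cfc Real.sin X = (2 * Complex.I) • cfc Real.sin Y := by
    have := congrArg₂ (· - ·) h2 h3
    have e : ∀ C S : H →L[ℂ] H, C + Complex.I • S - (C + star Complex.I • S)
        = (2 * Complex.I) • S := fun C S => by
      simp [two_mul, add_smul]
    simpa only [e] using this
  have h5 : cfc Real.sin X = cfc Real.sin Y := smul_right_injective _ (by simp) h4
  rw [← cfc_arcsin_cfc_sin hX hXn, h5, cfc_arcsin_cfc_sin hY hYn]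

/-- With `W` the sign of `R + R'`, the unitary `W R` must be `exp (iX)`. Its real part is `|R + R'|
/ 2 ≥ 0`, so taking the arcsine of its imaginary part loses nothing. -/
lemma exists_exponent {R R' : H →L[ℂ] H} (hR : IsSelfAdjoint R) (hR2 : R * R = 1)
    (hR' : IsSelfAdjoint R') (hR'2 : R' * R' = 1) (hinj : Function.Injective (R + R')) :
    ∃ X : H →L[ℂ] H, IsSelfAdjoint X ∧ ‖X‖ ≤ Real.pi / 2 ∧ R * X = -(X * R) ∧
      R' * X = -(X * R') ∧
      NormedSpace.exp (Complex.I • X) * R = R' * NormedSpace.exp (Complex.I • X) := by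
  have hAs : IsSelfAdjoint (R + R') := hR.add hR'
  obtain ⟨W, hW, hW2, hWA, hWc⟩ := exists_sign hAs hinj
  have hB := isSelfAdjoint_abs (R + R')
  have hB0 := CFC.abs_nonneg (R + R')
  have hBd := denseRange_of_selfAdjoint_injective hB (injective_abs hinj)
  have hBB : CFC.abs (R + R') * CFC.abs (R + R') = (R + R') * (R + R') := by
    rw [CFC.abs_mul_abs, hAs.star_eq]
  have hsq : (R + R') * (R + R') = 2 + R * R' + R' * R := by
    rw [add_mul, mul_add, mul_add, hR2, hR'2, ← one_add_one_eq_two]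
    abel
  have hcomm : ∀ T : H →L[ℂ] H, Commute T ((R + R') * (R + R')) →
      T * CFC.abs (R + R') = CFC.abs (R + R') * T := fun T hT => by
    rw [CFC.abs, hAs.star_eq]
    exact (hT.symm.cfcₙ_nnreal _).eq.symm
  have hRB : R * CFC.abs (R + R') = CFC.abs (R + R') * R := by
    refine hcomm R ?_
    rw [hsq]
    change R * _ = _ * R
    simp only [mul_add, add_mul, ← mul_assoc, hR2, one_mul]
    simp only [mul_assoc, hR2, mul_one]
    rw [mul_two, two_mul]
    abel
  have hR'B : R' * CFC.abs (R + R') = CFC.abs (R + R') * R' := by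
    refine hcomm R' ?_
    rw [hsq]
    change R' * _ = _ * R'
    simp only [mul_add, add_mul, ← mul_assoc, hR'2, one_mul]
    simp only [mul_assoc, hR'2, mul_one]
    rw [mul_two, two_mul]
    abel
  set B := CFC.abs (R + R')
  -- Both sides times `|R + R'|` equal `1 + R R'`.
  have hRW : R * W = W * R' := by
    refine eq_of_mul_eq_of_denseRange hBd ?_
    rw [mul_assoc, hWA, mul_assoc, hR'B, ← mul_assoc, hWA, mul_add, add_mul, hR2, hR'2, add_comm]
  have hR'eq : R' = W * R * W := by rw [mul_assoc, hRW, ← mul_assoc, hW2, one_mul]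
  have hWR : W * R + R * W = B := by
    refine eq_of_mul_eq_of_denseRange hBd ?_
    rw [add_mul, mul_assoc, hRB, ← mul_assoc, hWA, mul_assoc, hWA, hBB, hsq, add_mul, mul_add, hR2,
      ← one_add_one_eq_two]
    abel
  -- The imaginary part of `W R`, whose adjoint is `R W`.
  let Y : H →L[ℂ] H := (-(Complex.I / 2)) • (W * R - R * W)
  have hYdef : Y = (-(Complex.I / 2)) • (W * R - R * W) := rfl
  have hYs : IsSelfAdjoint Y := by
    rw [IsSelfAdjoint, hYdef, star_smul, star_sub, star_mul, star_mul, hW.star_eq, hR.star_eq,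
      ← neg_sub (W * R), smul_neg, ← neg_smul]
    congr 1
    simp [neg_div]
  have hV1 : W * R * (R * W) = 1 := by rw [mul_assoc, ← mul_assoc R, hR2, one_mul, hW2]
  have hV2 : R * W * (W * R) = 1 := by rw [mul_assoc, ← mul_assoc W, hW2, one_mul, hR2]
  have hYB : Complex.I • Y + (2⁻¹ : ℂ) • B = W * R := by
    rw [hYdef, ← hWR, smul_smul]
    have : Complex.I * -(Complex.I / 2) = 2⁻¹ := by
      linear_combination (-(1 : ℂ) / 2) * Complex.I_mul_I
    rw [this, ← smul_add]
    rw [show W * R - R * W + (W * R + R * W) = (2 : ℂ) • (W * R) by rw [two_smul]; abel, smul_smul]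
    simp
  have hYY : Y * Y + ((2⁻¹ : ℝ) • B) * ((2⁻¹ : ℝ) • B) = 1 := by
    have e1 : (W * R - R * W) * (W * R - R * W) =
        W * R * (W * R) + R * W * (R * W) - 2 := by
      rw [sub_mul, mul_sub, mul_sub, hV1, hV2, ← one_add_one_eq_two]
      abel
    have e2 : B * B = W * R * (W * R) + R * W * (R * W) + 2 := by
      rw [← hWR, add_mul, mul_add, mul_add, hV1, hV2, ← one_add_one_eq_two]
      abel
    have e3 : Y * Y = (-(1 / 4) : ℝ) • ((W * R - R * W) * (W * R - R * W)) := by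
      rw [hYdef, smul_mul_smul_comm]
      have : (-(Complex.I / 2)) * (-(Complex.I / 2)) = ((-(1 / 4) : ℝ) : ℂ) := by
        push_cast
        linear_combination ((1 : ℂ) / 4) * Complex.I_mul_I
      rw [this, Complex.coe_smul]
    rw [e3, smul_mul_smul_comm, e1, e2]
    rw [show (2 : H →L[ℂ] H) = (2 : ℝ) • 1 by rw [two_smul, one_add_one_eq_two]]
    module
  have hWn : ‖W * R‖ ≤ 1 := by
    refine norm_le_one_of_star_mul_self_eq_one ?_
    rw [star_mul, hW.star_eq, hR.star_eq]
    exact hV2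
  have hWn' : ‖R * W‖ ≤ 1 := by
    refine norm_le_one_of_star_mul_self_eq_one ?_
    rw [star_mul, hW.star_eq, hR.star_eq]
    exact hV1
  have hYn : ‖Y‖ ≤ 1 := by
    rw [hYdef, norm_smul]
    have := norm_sub_le (W * R) (R * W)
    have h2 : ‖-(Complex.I / 2)‖ = 1 / 2 := by simp
    rw [h2]
    linarith
  have hRY : R * Y = -(Y * R) := by
    rw [hYdef, mul_smul_comm, smul_mul_assoc, ← smul_neg, mul_sub, sub_mul, neg_sub]
    simp only [← mul_assoc, hR2]
    simp only [mul_assoc, hR2, one_mul, mul_one]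
  have hR'Y : R' * Y = -(Y * R') := by
    rw [hYdef, mul_smul_comm, smul_mul_assoc, ← smul_neg, mul_sub, sub_mul, neg_sub, hR'eq]
    have e1 : W * R * W * (W * R) = W := by rw [mul_assoc (W * R), ← mul_assoc W W, hW2, one_mul,
      mul_assoc, hR2, mul_one]
    have e2 : R * W * (W * R * W) = W := by rw [mul_assoc W R, ← mul_assoc (R * W), mul_assoc R W,
      hW2, mul_one, ← mul_assoc, hR2, one_mul]
    rw [e1, e2]
    simp only [mul_assoc]
  have hspec : ∀ x ∈ spectrum ℝ Y, -1 ≤ x ∧ x ≤ 1 := fun x hx =>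
    abs_le.1 ((abs_le_norm_of_mem_spectrum hx).trans hYn)
  have hac := Real.continuous_arcsin
  let X := cfc Real.arcsin Y
  have hX : IsSelfAdjoint X := cfc_predicate _ _
  have hsin : cfc Real.sin X = Y := by
    rw [← cfc_comp Real.sin Real.arcsin Y hYs Real.continuous_sin.continuousOn hac.continuousOn]
    conv_rhs => rw [← cfc_id ℝ Y]
    exact cfc_congr fun x hx => Real.sin_arcsin (hspec x hx).1 (hspec x hx).2
  have hXn : ‖X‖ ≤ Real.pi / 2 := by
    refine norm_cfc_le (by positivity) fun x _ => ?_
    exact abs_le.2 ⟨Real.neg_pi_div_two_le_arcsin x, Real.arcsin_le_pi_div_two x⟩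
  -- Both sides are the positive square root of `1 - Y²`.
  have hcos : cfc Real.cos X = (2⁻¹ : ℝ) • B := by
    have h1 := cfc_sin_sq_add_cfc_cos_sq hX
    rw [hsin, ← hYY] at h1
    have h2 := add_left_cancel h1
    rw [← CFC.sqrt_unique (a := cfc Real.cos X * cfc Real.cos X) rfl (cfc_cos_nonneg hXn), h2]
    exact CFC.sqrt_unique rfl (smul_nonneg (by norm_num) hB0)
  have hexp : NormedSpace.exp (Complex.I • X) = W * R := by
    rw [exp_I_smul_eq hX, hsin, hcos, ← hYB, add_comm]
    congr 1
    rw [← Complex.coe_smul]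
    simp
  refine ⟨X, hX, hXn, anticommute_cfc_of_odd hR hR2 hYs hRY hac Real.arcsin_neg,
    anticommute_cfc_of_odd hR' hR'2 hYs hR'Y hac Real.arcsin_neg, ?_⟩
  rw [hexp, hR'eq, mul_assoc (W * R), ← mul_assoc W W, hW2, one_mul]

end Grassmann

/-! ### Lower bound for the length of curves of projections -/

namespace Grassmann

open scoped InnerProductSpace
open MeasureTheory

section Curves

variable {F : Type*} [NormedAddCommGroup F] [NormedSpace ℝ F]

lemma hasDerivAt_of_contDiffOn_Icc {β : ℝ → F} {a b : ℝ} (hβ : ContDiffOn ℝ ∞ β (Icc a b)) {t : ℝ}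
    (ht : t ∈ Ioo a b) : HasDerivAt β (deriv β t) t :=
  ((hβ.differentiableOn (by simp)).differentiableAt (Icc_mem_nhds ht.1 ht.2)).hasDerivAt

/-- At the endpoints `deriv` depends on values outside the interval; on the interior it agrees with
the continuous `derivWithin`, and endpoints are negligible. -/
lemma intervalIntegrable_norm_deriv {β : ℝ → F} {a b : ℝ} (hab : a ≤ b)
    (hβ : ContDiffOn ℝ ∞ β (Icc a b)) : IntervalIntegrable (fun t => ‖deriv β t‖) volume a b := by
  rcases hab.eq_or_lt with rfl | hab
  · exact IntervalIntegrable.refl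
  have hc : ContinuousOn (fun t => ‖derivWithin β (Icc a b) t‖) (uIcc a b) := by
    rw [uIcc_of_le hab.le]
    exact (hβ.continuousOn_derivWithin (uniqueDiffOn_Icc hab) (by simp)).norm
  refine (intervalIntegrable_iff_integrableOn_Ioo_of_le hab.le).2 ?_
  refine ((intervalIntegrable_iff_integrableOn_Ioo_of_le hab.le).1
    hc.intervalIntegrable).congr_fun (fun t ht => ?_) measurableSet_Ioo
  simp only [derivWithin_of_mem_nhds (Icc_mem_nhds ht.1 ht.2)]

end Curves

variable {H : Type*} [NormedAddCommGroup H] [InnerProductSpace ℂ H]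

/-- The real part of the quadratic form of an operator, at a fixed vector. -/
def expectation (ξ : H) : (H →L[ℂ] H) →L[ℝ] ℝ :=
  Complex.reCLM ∘L ((innerSL ℂ ξ).restrictScalars ℝ) ∘L
    ((ContinuousLinearMap.apply ℂ H ξ).restrictScalars ℝ)

lemma expectation_apply (ξ : H) (T : H →L[ℂ] H) :
    expectation ξ T = (⟪ξ, T ξ⟫_ℂ).re := rfl

lemma length_nonneg (β : ℝ → (H →L[ℂ] H)) : 0 ≤ length β :=
  intervalIntegral.integral_nonneg zero_le_one fun _ _ => norm_nonneg _

variable [CompleteSpace H]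

lemma norm_sq_apply_of_isStarProjection {P : H →L[ℂ] H} (hP : IsStarProjection P) (ξ : H) :
    ‖P ξ‖ ^ 2 = expectation ξ P := by
  rw [expectation_apply, ← inner_self_eq_norm_sq (𝕜 := ℂ), ← ContinuousLinearMap.adjoint_inner_right,
    ← ContinuousLinearMap.star_eq_adjoint, hP.isSelfAdjoint.star_eq, ← mul_apply_eq_comp,
    hP.isIdempotentElem.eq]
  rfl

lemma norm_sq_sub_apply_of_isStarProjection {P : H →L[ℂ] H} (hP : IsStarProjection P) (ξ : H) :
    ‖ξ - P ξ‖ ^ 2 = ‖ξ‖ ^ 2 - ‖P ξ‖ ^ 2 := by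
  have h := norm_sq_apply_of_isStarProjection hP.one_sub ξ
  rw [map_sub, ← norm_sq_apply_of_isStarProjection hP, expectation_apply] at h
  simp only [sub_apply, one_apply_eq_self] at h
  rw [h, ← inner_self_eq_norm_sq (𝕜 := ℂ) ξ]
  rfl

lemma isSelfAdjoint_two_smul_sub_one {P : H →L[ℂ] H} (hP : IsStarProjection P) :
    IsSelfAdjoint (2 • P - 1) := by
  rw [IsSelfAdjoint, star_sub, star_nsmul, hP.isSelfAdjoint.star_eq, star_one]

lemma two_smul_sub_one_mul_self {P : H →L[ℂ] H} (hP : IsStarProjection P) :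
    (2 • P - 1) * (2 • P - 1) = 1 := by
  rw [mul_sub, sub_mul, mul_one, one_mul, smul_mul_smul_comm, hP.isIdempotentElem.eq]
  module

/-- The velocity of a curve of projections is bounded in terms of the quadratic form. -/
lemma abs_expectation_le {P T : H →L[ℂ] H} (hP : IsStarProjection P) (hT : T = T * P + P * T)
    (ξ : H) : |expectation ξ T| ≤ 2 * ‖T‖ * (‖P ξ‖ * ‖ξ - P ξ‖) := by
  have hPP := hP.isIdempotentElem.eq
  -- Compressing the hypothesis by `P` gives `PTP = 2 PTP`.
  have h0 : P * T * P = 0 := by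
    have h := congrArg (fun S => P * S * P) hT
    simp only [mul_add, add_mul] at h
    rw [mul_assoc P (T * P), mul_assoc T, hPP, ← mul_assoc P P, hPP, ← mul_assoc P T] at h
    simpa using h
  have hsym : ∀ x y, ⟪P x, y⟫_ℂ = ⟪x, P y⟫_ℂ := fun x y => by
    rw [← ContinuousLinearMap.adjoint_inner_right, ← ContinuousLinearMap.star_eq_adjoint,
      hP.isSelfAdjoint.star_eq]
  have hz : ⟪P ξ, T (P ξ)⟫_ℂ = 0 := by
    rw [hsym]
    have := congrArg (fun S : H →L[ℂ] H => S ξ) h0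
    simp only [mul_apply_eq_comp, zero_apply] at this
    rw [this, inner_zero_right]
  have h1 : ⟪ξ, T ξ⟫_ℂ = ⟪ξ - P ξ, T (P ξ)⟫_ℂ + ⟪P ξ, T (ξ - P ξ)⟫_ℂ := by
    rw [inner_sub_left, map_sub, inner_sub_right, hz, sub_zero, sub_zero, hsym, ← inner_add_right]
    congr 1
    exact congrArg (fun S : H →L[ℂ] H => S ξ) hT
  rw [expectation_apply]
  refine (Complex.abs_re_le_norm _).trans ?_
  rw [h1]
  refine (norm_add_le _ _).trans ?_
  have h2 : ‖⟪ξ - P ξ, T (P ξ)⟫_ℂ‖ ≤ ‖ξ - P ξ‖ * (‖T‖ * ‖P ξ‖) :=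
    (norm_inner_le_norm _ _).trans (by gcongr; exact T.le_opNorm _)
  have h3 : ‖⟪P ξ, T (ξ - P ξ)⟫_ℂ‖ ≤ ‖P ξ‖ * (‖T‖ * ‖ξ - P ξ‖) :=
    (norm_inner_le_norm _ _).trans (by gcongr; exact T.le_opNorm _)
  linarith

/-- Variation of the angle along a smooth piece of a curve of projections, with a parameter `k`
that keeps the arccosine away from its singularities. -/
lemma arccos_sub_le {β : ℝ → (H →L[ℂ] H)} {a b : ℝ} (hab : a ≤ b)
    (hβ : ContDiffOn ℝ ∞ β (Icc a b)) (hP : ∀ t ∈ Icc a b, IsStarProjection (β t)) {ξ : H}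
    (hξ : ‖ξ‖ = 1) {k : ℝ} (hk : |k| < 1) :
    Real.arccos (k * (2 * ‖β b ξ‖ ^ 2 - 1)) - Real.arccos (k * (2 * ‖β a ξ‖ ^ 2 - 1)) ≤
      ∫ t in a..b, 2 * ‖deriv β t‖ := by
  let f : ℝ → ℝ := fun t => k * (2 * expectation ξ (β t) - 1)
  have hle : ∀ t ∈ Icc a b, |2 * expectation ξ (β t) - 1| ≤ 1 := fun t ht => by
    have h1 := norm_sq_sub_apply_of_isStarProjection (hP t ht) ξ
    rw [← norm_sq_apply_of_isStarProjection (hP t ht)]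
    rw [hξ] at h1
    rw [abs_le]
    constructor <;> nlinarith [sq_nonneg ‖ξ - β t ξ‖, sq_nonneg ‖β t ξ‖]
  have hf1 : ∀ t ∈ Icc a b, |f t| < 1 := fun t ht => by
    simp only [f, abs_mul]
    nlinarith [hle t ht, abs_nonneg k, abs_nonneg (2 * expectation ξ (β t) - 1)]
  have h : Real.arccos (f b) - Real.arccos (f a) ≤ ∫ t in a..b, 2 * ‖deriv β t‖ := by
    refine intervalIntegral.sub_le_integral_of_hasDeriv_right_of_le
      (g := fun t => Real.arccos (f t))
      (g' := fun t => -(1 / √(1 - f t ^ 2)) * (k * (2 * expectation ξ (deriv β t))))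
      hab ?_ ?_ ?_ ?_
    · refine Real.continuous_arccos.comp_continuousOn ?_
      have := (expectation ξ).continuous.comp_continuousOn hβ.continuousOn
      exact continuousOn_const.mul ((continuousOn_const.mul this).sub continuousOn_const)
    · intro t ht
      have h1 := hf1 t (Ioo_subset_Icc_self ht)
      rw [abs_lt] at h1
      have h2 : HasDerivAt f (k * (2 * expectation ξ (deriv β t))) t :=
        ((((expectation ξ).hasFDerivAt.comp_hasDerivAt t
          (hasDerivAt_of_contDiffOn_Icc hβ ht)).const_mul 2).sub_const 1).const_mul k
      exact ((Real.hasDerivAt_arccos h1.1.ne' h1.2.ne).comp t h2).hasDerivWithinAt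
    · have := (intervalIntegrable_norm_deriv hab hβ).const_mul 2
      rwa [intervalIntegrable_iff_integrableOn_Icc_of_le hab] at this
    · intro t ht
      have htI := Ioo_subset_Icc_self ht
      have hPt := hP t htI
      have hd := hasDerivAt_of_contDiffOn_Icc hβ ht
      have hT : deriv β t = deriv β t * β t + β t * deriv β t := by
        refine hd.unique ((hd.mul hd).congr_of_eventuallyEq ?_)
        filter_upwards [Icc_mem_nhds ht.1 ht.2] with s hs
        exact (hP s hs).isIdempotentElem.eq.symm
      have h1 := abs_expectation_le hPt hT ξ
      have hf := hf1 t htI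
      have hpos : 0 < 1 - f t ^ 2 := by
        rw [abs_lt] at hf
        nlinarith
      have hk2 : k ^ 2 ≤ 1 := by
        rw [abs_lt] at hk
        nlinarith
      -- With `x` the quadratic form of `β t` at `ξ`, the squares are `4k²x(1 - x)` and `1 - k²(2x -
      -- 1)²`, which differ by `1 - k² ≥ 0`.
      have h2 : |k| * (2 * (‖β t ξ‖ * ‖ξ - β t ξ‖)) ≤ √(1 - f t ^ 2) := by
        refine Real.le_sqrt_of_sq_le ?_
        have e : ‖ξ - β t ξ‖ ^ 2 = 1 - expectation ξ (β t) := by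
          rw [norm_sq_sub_apply_of_isStarProjection hPt, hξ, norm_sq_apply_of_isStarProjection hPt,
            one_pow]
        rw [mul_pow, mul_pow, mul_pow, sq_abs, norm_sq_apply_of_isStarProjection hPt, e]
        simp only [f]
        linarith
      have hs := Real.sqrt_pos.2 hpos
      refine (le_abs_self _).trans ?_
      rw [abs_mul, abs_neg, abs_of_pos (by positivity : (0 : ℝ) < 1 / √(1 - f t ^ 2)), abs_mul, abs_mul,
        one_div, inv_mul_le_iff₀ hs, abs_two]
      calc |k| * (2 * |expectation ξ (deriv β t)|)
          ≤ |k| * (2 * (2 * ‖deriv β t‖ * (‖β t ξ‖ * ‖ξ - β t ξ‖))) := by gcongr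
        _ = (|k| * (2 * (‖β t ξ‖ * ‖ξ - β t ξ‖))) * (2 * ‖deriv β t‖) := by ring
        _ ≤ _ := by gcongr
  simpa only [f, norm_sq_apply_of_isStarProjection (hP a (left_mem_Icc.2 hab)),
    norm_sq_apply_of_isStarProjection (hP b (right_mem_Icc.2 hab))] using h

lemma arccos_sub_le_length {β : ℝ → (H →L[ℂ] H)} (hβ : IsPiecewiseSmoothCurve β) {ξ : H}
    (hξ : ‖ξ‖ = 1) {k : ℝ} (hk : |k| < 1) :
    Real.arccos (k * (2 * ‖β 1 ξ‖ ^ 2 - 1)) - Real.arccos (k * (2 * ‖β 0 ξ‖ ^ 2 - 1)) ≤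
      2 * length β := by
  obtain ⟨hGr, n, s, hs, hs0, hsn, hsm⟩ := hβ
  have hsub : ∀ i < n, Icc (s i) (s (i + 1)) ⊆ Icc 0 1 := fun i hi => by
    rw [← hs0, ← hsn]
    exact Icc_subset_Icc (hs (Nat.zero_le i)) (hs hi)
  have h1 := Finset.sum_le_sum fun i (hi : i ∈ Finset.range n) =>
    arccos_sub_le (hs (Nat.le_succ i)) (hsm i (Finset.mem_range.1 hi))
      (fun t ht => hGr t (hsub i (Finset.mem_range.1 hi) ht)) hξ hk
  rw [Finset.sum_range_sub (fun i => Real.arccos (k * (2 * ‖β (s i) ξ‖ ^ 2 - 1))),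
    intervalIntegral.sum_integral_adjacent_intervals fun i hi =>
      (intervalIntegrable_norm_deriv (hs (Nat.le_succ i)) (hsm i hi)).const_mul 2,
    hs0, hsn, intervalIntegral.integral_const_mul] at h1
  exact h1

/-- Limit `k → 1`. If `θ` is the angle between `ξ` and the subspace, then `‖β ξ‖² = cos² θ` and the
arccosine is `2θ`. -/
lemma arccos_le_arccos_add_length {β : ℝ → (H →L[ℂ] H)} (hβ : IsPiecewiseSmoothCurve β) {ξ : H}
    (hξ : ‖ξ‖ = 1) :
    Real.arccos (2 * ‖β 1 ξ‖ ^ 2 - 1) ≤ Real.arccos (2 * ‖β 0 ξ‖ ^ 2 - 1) + 2 * length β := by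
  have ht : Tendsto (fun k : ℝ => Real.arccos (k * (2 * ‖β 1 ξ‖ ^ 2 - 1))
      - Real.arccos (k * (2 * ‖β 0 ξ‖ ^ 2 - 1))) (𝓝[<] 1)
      (𝓝 (Real.arccos (1 * (2 * ‖β 1 ξ‖ ^ 2 - 1)) - Real.arccos (1 * (2 * ‖β 0 ξ‖ ^ 2 - 1)))) := by
    refine Tendsto.mono_left (Continuous.tendsto ?_ 1) nhdsWithin_le_nhds
    have := Real.continuous_arccos
    fun_prop
  have h := le_of_tendsto ht (b := 2 * length β) (by
    filter_upwards [Ioo_mem_nhdsLT (show (0 : ℝ) < 1 by norm_num)] with k hk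
    exact arccos_sub_le_length hβ hξ (by rw [abs_of_pos hk.1]; exact hk.2))
  rw [one_mul, one_mul] at h
  linarith

/-- Limit `k → -1`; `arccos (-x) = π - arccos x` reverses the roles of the endpoints. -/
lemma arccos_le_arccos_add_length' {β : ℝ → (H →L[ℂ] H)} (hβ : IsPiecewiseSmoothCurve β) {ξ : H}
    (hξ : ‖ξ‖ = 1) :
    Real.arccos (2 * ‖β 0 ξ‖ ^ 2 - 1) ≤ Real.arccos (2 * ‖β 1 ξ‖ ^ 2 - 1) + 2 * length β := by
  have ht : Tendsto (fun k : ℝ => Real.arccos (k * (2 * ‖β 1 ξ‖ ^ 2 - 1))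
      - Real.arccos (k * (2 * ‖β 0 ξ‖ ^ 2 - 1))) (𝓝[>] (-1))
      (𝓝 (Real.arccos (-1 * (2 * ‖β 1 ξ‖ ^ 2 - 1))
        - Real.arccos (-1 * (2 * ‖β 0 ξ‖ ^ 2 - 1)))) := by
    refine Tendsto.mono_left (Continuous.tendsto ?_ (-1)) nhdsWithin_le_nhds
    have := Real.continuous_arccos
    fun_prop
  have h := le_of_tendsto ht (b := 2 * length β) (by
    filter_upwards [Ioo_mem_nhdsGT (show (-1 : ℝ) < 0 by norm_num)] with k hk
    exact arccos_sub_le_length hβ hξ (by rw [abs_of_neg hk.2]; linarith [hk.1]))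
  rw [neg_one_mul, neg_one_mul, Real.arccos_neg, Real.arccos_neg] at h
  linarith

/-- The distance between the end points of a short curve is at most the sine of its length. -/
lemma norm_sub_le_sin_length {β : ℝ → (H →L[ℂ] H)} (hβ : IsPiecewiseSmoothCurve β)
    (hL : length β ≤ Real.pi / 2) : ‖β 0 - β 1‖ ≤ Real.sin (length β) := by
  have hP : IsStarProjection (β 0) := hβ.1 0 (by simp)
  have hQ : IsStarProjection (β 1) := hβ.1 1 (by simp)
  have hL0 := length_nonneg β
  have hs0 : 0 ≤ Real.sin (length β) :=
    Real.sin_nonneg_of_nonneg_of_le_pi hL0 (by linarith [Real.pi_pos])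
  have hcos : Real.cos (2 * length β) = 1 - 2 * Real.sin (length β) ^ 2 := by
    rw [Real.cos_two_mul, Real.cos_sq']
    ring
  have h1 : ∀ x, ‖x‖ = 1 → β 0 x = x → ‖x - β 1 x‖ ≤ Real.sin (length β) := fun x hx hx0 => by
    have h := arccos_le_arccos_add_length hβ hx
    rw [hx0, hx, show (2 * 1 ^ 2 - 1 : ℝ) = 1 by norm_num, Real.arccos_one, zero_add] at h
    have hq := norm_sq_sub_apply_of_isStarProjection hQ x
    rw [hx] at hq
    have h2 := Real.cos_le_cos_of_nonneg_of_le_pi (Real.arccos_nonneg _) (by linarith) h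
    rw [hcos, Real.cos_arccos (by nlinarith [sq_nonneg ‖β 1 x‖])
      (by nlinarith [sq_nonneg ‖x - β 1 x‖])] at h2
    refine (sq_le_sq₀ (norm_nonneg _) hs0).1 ?_
    linarith
  have h2 : ∀ y, ‖y‖ = 1 → β 0 y = 0 → ‖β 1 y‖ ≤ Real.sin (length β) := fun y hy hy0 => by
    have h := arccos_le_arccos_add_length' hβ hy
    rw [hy0, norm_zero, show (2 * 0 ^ 2 - 1 : ℝ) = -1 by norm_num, Real.arccos_neg_one] at h
    have hq := norm_sq_sub_apply_of_isStarProjection hQ y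
    rw [hy] at hq
    have h2 := Real.cos_le_cos_of_nonneg_of_le_pi (x := Real.pi - 2 * length β) (by linarith)
      (Real.arccos_le_pi _) (by linarith)
    rw [Real.cos_pi_sub, hcos, Real.cos_arccos (by nlinarith [sq_nonneg ‖β 1 y‖])
      (by nlinarith [sq_nonneg ‖y - β 1 y‖])] at h2
    refine (sq_le_sq₀ (norm_nonneg _) hs0).1 ?_
    linarith
  have homog : ∀ (T : H →L[ℂ] H) (x : H), (x ≠ 0 → ‖T ((‖x‖⁻¹ : ℂ) • x)‖ ≤ Real.sin (length β)) →
      ‖T x‖ ≤ Real.sin (length β) * ‖x‖ := fun T x h => by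
    by_cases hx : x = 0
    · simp [hx]
    have := h hx
    rw [ContinuousLinearMap.map_smul, norm_smul, norm_inv, Complex.norm_real, norm_norm, inv_mul_le_iff₀
      (norm_pos_iff.2 hx)] at this
    linarith
  have hunit : ∀ x : H, x ≠ 0 → ‖(‖x‖⁻¹ : ℂ) • x‖ = 1 := fun x hx => by
    rw [norm_smul, norm_inv, Complex.norm_real, norm_norm, inv_mul_cancel₀ (norm_ne_zero_iff.2 hx)]
  refine ContinuousLinearMap.opNorm_le_bound _ hs0 fun η => ?_
  have hPP : β 0 (β 0 η) = β 0 η := by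
    rw [← mul_apply_eq_comp, hP.isIdempotentElem.eq]
  have hQQ : ∀ z, β 1 (β 1 z) = β 1 z := fun z => by
    rw [← mul_apply_eq_comp, hQ.isIdempotentElem.eq]
  have hx := homog (1 - β 1) (β 0 η) fun h0 => by
    exact h1 ((‖β 0 η‖⁻¹ : ℂ) • β 0 η) (hunit _ h0) (by rw [ContinuousLinearMap.map_smul, hPP])
  have hy := homog (β 1) (η - β 0 η) fun h0 => by
    refine h2 _ (hunit _ h0) ?_
    rw [ContinuousLinearMap.map_smul, map_sub, hPP, sub_self, smul_zero]
  -- The two terms lie in the kernel and the range of `β 1`, hence are orthogonal, and Pythagoras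
  -- combines the two estimates.
  have hdec : (β 0 - β 1) η = (1 - β 1) (β 0 η) - β 1 (η - β 0 η) := by
    simp only [sub_apply, one_apply_eq_self, map_sub]
    abel
  have horth : ⟪(1 - β 1) (β 0 η), β 1 (η - β 0 η)⟫_ℂ = 0 := by
    have hsa : star (β 1) = β 1 := hQ.isSelfAdjoint.star_eq
    rw [← ContinuousLinearMap.adjoint_inner_left, ← ContinuousLinearMap.star_eq_adjoint, hsa]
    simp only [sub_apply, one_apply_eq_self, map_sub, hQQ, sub_self]
    exact inner_zero_left _
  have hpyth := norm_sub_sq (𝕜 := ℂ) ((1 - β 1) (β 0 η)) (β 1 (η - β 0 η))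
  rw [horth, map_zero, mul_zero, sub_zero] at hpyth
  have hη := norm_sq_sub_apply_of_isStarProjection hP η
  rw [hdec]
  refine (sq_le_sq₀ (norm_nonneg _) (by positivity)).1 ?_
  have hx2 := pow_le_pow_left₀ (norm_nonneg _) hx 2
  have hy2 := pow_le_pow_left₀ (norm_nonneg _) hy 2
  rw [mul_pow] at hx2 hy2 ⊢
  rw [hη] at hy2
  nlinarith

/-- A lower bound for the length of curves joining two subspaces in terms of an exponent. -/
lemma norm_le_length {X : H →L[ℂ] H} {β : ℝ → (H →L[ℂ] H)} (hβ : IsPiecewiseSmoothCurve β)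
    (hX : IsSelfAdjoint X) (hn : ‖X‖ ≤ Real.pi / 2)
    (h : (2 • β 0 - 1) * X = -(X * (2 • β 0 - 1)))
    (hexp : NormedSpace.exp (Complex.I • X) * (2 • β 0 - 1) =
      (2 • β 1 - 1) * NormedSpace.exp (Complex.I • X)) :
    ‖X‖ ≤ length β := by
  rcases le_total (Real.pi / 2) (length β) with hL | hL
  · exact hn.trans hL
  have hP : IsStarProjection (β 0) := hβ.1 0 (by simp)
  have hnorm := norm_sub_le_sin_length hβ hL
  have h1 := two_mul_norm_cfc_sin_le (isSelfAdjoint_two_smul_sub_one hP)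
    (two_smul_sub_one_mul_self hP) hX h hexp
  have h2 : 2 • β 0 - 1 - (2 • β 1 - 1) = (2 : ℝ) • (β 0 - β 1) := by module
  rw [h2, norm_smul, Real.norm_two] at h1
  have hL0 := length_nonneg β
  -- The spectrum of `sin X` lies in `[-sin L, sin L]` with `L ≤ π/2`, so that of its arcsine lies
  -- in `[-L, L]`.
  rw [← cfc_arcsin_cfc_sin hX hn]
  refine norm_cfc_le hL0 fun x hx => ?_
  have hx1 : |x| ≤ Real.sin (length β) := (abs_le_norm_of_mem_spectrum hx).trans (by linarith)
  rw [abs_le] at hx1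
  have h3 := Real.arcsin_sin (x := length β) (by linarith) hL
  rw [Real.norm_eq_abs, abs_le]
  constructor
  · rw [← h3, ← Real.arcsin_neg]
    exact Real.monotone_arcsin hx1.1
  · rw [← h3]
    exact Real.monotone_arcsin hx1.2

end Grassmann

/-! ### Geodesics and their exponents -/

namespace Grassmann

open scoped InnerProductSpace
open MeasureTheory

variable {H : Type*} [NormedAddCommGroup H] [InnerProductSpace ℂ H]

lemma eq_of_two_nsmul_eq {F : Type*} [AddCommGroup F] [Module ℝ F] {x y : F}
    (h : (2 : ℕ) • x = (2 : ℕ) • y) : x = y := by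
  have h1 : ∀ z : F, z = (2⁻¹ : ℝ) • ((2 : ℕ) • z) := fun z => by module
  rw [h1 x, h, ← h1 y]

lemma tangentProj_eq_zero_of_commute {P T : H →L[ℂ] H} (hP : IsIdempotentElem P)
    (h : Commute P T) : tangentProj P T = 0 := by
  have h1 : P * (1 - P) = 0 := by rw [mul_sub, mul_one, hP.eq, sub_self]
  have h2 : (1 - P) * P = 0 := by rw [sub_mul, one_mul, hP.eq, sub_self]
  rw [tangentProj, h.eq, mul_assoc T, h1, mul_zero, zero_add, mul_assoc (1 - P), ← h.eq,
    ← mul_assoc, h2, zero_mul]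

/-- With `R = 2P - 1`, `RX + XR = 2(PX + XP - X)`, which vanishes exactly when both diagonal blocks
of `X` do. -/
lemma codiagonal_iff {S : Submodule ℂ H} [S.HasOrthogonalProjection] (X : H →L[ℂ] H) :
    ((∀ f ∈ S, X f ∈ Sᗮ) ∧ (∀ f ∈ Sᗮ, X f ∈ S)) ↔
      (2 • S.starProjection - 1) * X = -(X * (2 • S.starProjection - 1)) := by
  have key : ∀ f, ((2 • S.starProjection - 1) * X + X * (2 • S.starProjection - 1) : H →L[ℂ] H) f =
      (2 : ℕ) • (S.starProjection (X f) + X (S.starProjection f) - X f) := fun f => by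
    simp only [add_apply, mul_apply_eq_comp, sub_apply, one_apply_eq_self, map_sub,
      smul_apply, map_nsmul]
    module
  constructor
  · rintro ⟨h1, h2⟩
    rw [eq_neg_iff_add_eq_zero]
    refine ContinuousLinearMap.ext fun f => ?_
    rw [key]
    have hf : f = S.starProjection f + (f - S.starProjection f) := by abel
    have hfS : S.starProjection f ∈ S := Submodule.starProjection_apply_mem _ _
    have hfT : f - S.starProjection f ∈ Sᗮ := Submodule.sub_starProjection_mem_orthogonal _
    have h3 : S.starProjection (X (S.starProjection f)) = 0 :=
      (Submodule.starProjection_apply_eq_zero_iff S).2 (h1 _ hfS)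
    have h4 : S.starProjection (X (f - S.starProjection f)) = X (f - S.starProjection f) :=
      Submodule.starProjection_eq_self_iff.2 (h2 _ hfT)
    have h5 : S.starProjection (X f) = X f - X (S.starProjection f) := by
      rw [map_sub, map_sub, h3, sub_zero] at h4
      exact h4
    rw [h5]
    simp
  · intro h
    rw [eq_neg_iff_add_eq_zero] at h
    have h1 : ∀ f, S.starProjection (X f) + X (S.starProjection f) - X f = 0 := fun f => by
      have := key f
      rw [h, zero_apply, ← smul_zero (2 : ℕ)] at this
      exact (eq_of_two_nsmul_eq (F := H) this).symm
    refine ⟨fun f hf => ?_, fun f hf => ?_⟩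
    · have := h1 f
      rw [Submodule.starProjection_eq_self_iff.2 hf, add_sub_cancel_right] at this
      exact (Submodule.starProjection_apply_eq_zero_iff S).1 this
    · have := h1 f
      rw [(Submodule.starProjection_apply_eq_zero_iff S).2 hf, map_zero, add_zero, sub_eq_zero] at this
      exact Submodule.starProjection_eq_self_iff.1 this

/-- A vector `x` in the kernel satisfies `P x = x - Q x`. This vector lies in `S ⊓ Tᗮ`, so it
vanishes, and then `x ∈ Sᗮ ⊓ T`. -/
lemma injective_reflection_add_reflection {S T : Submodule ℂ H} [S.HasOrthogonalProjection]
    [T.HasOrthogonalProjection] (h₁ : S ⊓ Tᗮ = ⊥) (h₂ : Sᗮ ⊓ T = ⊥) :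
    Function.Injective ((2 • S.starProjection - 1) + (2 • T.starProjection - 1) : H →L[ℂ] H) := by
  refine (injective_iff_map_eq_zero _).2 fun x hx => ?_
  have h : S.starProjection x = x - T.starProjection x := by
    have e : ((2 • S.starProjection - 1) + (2 • T.starProjection - 1) : H →L[ℂ] H) x =
        (2 : ℕ) • (S.starProjection x - (x - T.starProjection x)) := by
      simp only [add_apply, sub_apply, one_apply_eq_self, smul_apply]
      module
    rw [e, ← smul_zero (2 : ℕ)] at hx
    exact sub_eq_zero.1 (eq_of_two_nsmul_eq (F := H) hx)
  have h3 : S.starProjection x ∈ S ⊓ Tᗮ :=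
    ⟨Submodule.starProjection_apply_mem _ _, by
      rw [h]
      exact Submodule.sub_starProjection_mem_orthogonal _⟩
  rw [h₁, Submodule.mem_bot] at h3
  rw [h3, eq_comm, sub_eq_zero] at h
  have h4 : x ∈ Sᗮ ⊓ T :=
    ⟨(Submodule.starProjection_apply_eq_zero_iff S).1 h3, Submodule.starProjection_eq_self_iff.1 h.symm⟩
  rwa [h₂, Submodule.mem_bot] at h4

variable [CompleteSpace H]

/-- The one-parameter group `t ↦ exp (i t X)`. -/
def flow (X : H →L[ℂ] H) (t : ℝ) : H →L[ℂ] H := NormedSpace.exp (t • (Complex.I • X))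

lemma flow_zero (X : H →L[ℂ] H) : flow X 0 = 1 := by
  rw [flow, zero_smul, NormedSpace.exp_zero]

lemma flow_one (X : H →L[ℂ] H) : flow X 1 = NormedSpace.exp (Complex.I • X) := by
  rw [flow, one_smul]

lemma flow_add (X : H →L[ℂ] H) (s t : ℝ) : flow X (s + t) = flow X s * flow X t := by
  let : NormedAlgebra ℚ (H →L[ℂ] H) := NormedAlgebra.restrictScalars ℚ ℂ (H →L[ℂ] H)
  rw [flow, add_smul]
  exact NormedSpace.exp_add_of_commute (((Commute.refl _).smul_left s).smul_right t)

lemma flow_mul_flow_neg (X : H →L[ℂ] H) (t : ℝ) : flow X t * flow X (-t) = 1 := by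
  rw [← flow_add, add_neg_cancel, flow_zero]

lemma flow_neg_mul_flow (X : H →L[ℂ] H) (t : ℝ) : flow X (-t) * flow X t = 1 := by
  rw [← flow_add, neg_add_cancel, flow_zero]

lemma star_flow {X : H →L[ℂ] H} (hX : IsSelfAdjoint X) (t : ℝ) : star (flow X t) = flow X (-t) := by
  rw [flow, flow, NormedSpace.star_exp, star_smul, star_smul, hX.star_eq, neg_smul, ← smul_neg]
  simp

lemma reflection_mul_flow {R X : H →L[ℂ] H} (hR2 : R * R = 1) (h : R * X = -(X * R)) (t : ℝ) :
    R * flow X t = flow X (-t) * R := by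
  let : NormedAlgebra ℚ (H →L[ℂ] H) := NormedAlgebra.restrictScalars ℚ ℂ (H →L[ℂ] H)
  have h1 := NormedSpace.exp_units_conj (⟨R, R, hR2, hR2⟩ : (H →L[ℂ] H)ˣ) (t • (Complex.I • X))
  change NormedSpace.exp (R * (t • (Complex.I • X)) * R) = R * NormedSpace.exp _ * R at h1
  have h2 : R * (t • (Complex.I • X)) * R = (-t) • (Complex.I • X) := by
    rw [mul_smul_comm, mul_smul_comm, h, smul_mul_assoc, smul_mul_assoc, neg_mul, mul_assoc, hR2,
      mul_one, smul_neg, smul_neg, neg_smul]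
  rw [h2] at h1
  calc R * flow X t = R * flow X t * R * R := by rw [mul_assoc _ R R, hR2, mul_one]
    _ = _ := by rw [flow, ← h1, flow]

lemma hasDerivAt_flow (X : H →L[ℂ] H) (t : ℝ) :
    HasDerivAt (flow X) (flow X t * (Complex.I • X)) t :=
  hasDerivAt_exp_smul_const (𝕂 := ℝ) (Complex.I • X) t

lemma commute_flow (X : H →L[ℂ] H) (t : ℝ) : Commute (flow X t) (Complex.I • X) := by
  have h : Commute (Complex.I • X) (t • (Complex.I • X)) := (Commute.refl _).smul_right t
  let : NormedAlgebra ℚ (H →L[ℂ] H) := NormedAlgebra.restrictScalars ℚ ℂ (H →L[ℂ] H)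
  exact h.exp_right.symm

lemma contDiff_flow (X : H →L[ℂ] H) : ContDiff ℝ ∞ (flow X) := by
  have h : ContDiff ℝ ∞ (NormedSpace.exp : (H →L[ℂ] H) → (H →L[ℂ] H)) :=
    contDiff_iff_contDiffAt.2 fun x => (NormedSpace.exp_analytic (𝕂 := ℝ) x).contDiffAt
  exact h.comp (contDiff_id.smul contDiff_const)

/-- The geodesic `t ↦ exp (i t X) P exp (-i t X)`. -/
def geodesic (X P : H →L[ℂ] H) (t : ℝ) : H →L[ℂ] H := flow X t * P * flow X (-t)

lemma geodesic_zero (X P : H →L[ℂ] H) : geodesic X P 0 = P := by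
  rw [geodesic, neg_zero, flow_zero, one_mul, mul_one]

lemma geodesic_mem_Gr {X P : H →L[ℂ] H} (hX : IsSelfAdjoint X) (hP : IsStarProjection P) (t : ℝ) :
    IsStarProjection (geodesic X P t) := by
  constructor
  · rw [IsIdempotentElem, geodesic]
    calc flow X t * P * flow X (-t) * (flow X t * P * flow X (-t))
        = flow X t * P * (flow X (-t) * flow X t) * P * flow X (-t) := by simp only [mul_assoc]
      _ = _ := by rw [flow_neg_mul_flow, mul_one, mul_assoc _ P P, hP.isIdempotentElem.eq]
  · rw [IsSelfAdjoint, geodesic, star_mul, star_mul, star_flow hX, star_flow hX, neg_neg,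
      hP.isSelfAdjoint.star_eq, mul_assoc]

lemma range_geodesic (X P : H →L[ℂ] H) (t : ℝ) :
    (geodesic X P t).range = P.range.map (flow X t).toLinearMap := by
  ext y
  simp only [LinearMap.mem_range, Submodule.mem_map]
  constructor
  · rintro ⟨x, rfl⟩
    exact ⟨P (flow X (-t) x), ⟨_, rfl⟩, rfl⟩
  · rintro ⟨_, ⟨x, rfl⟩, rfl⟩
    refine ⟨flow X t x, ?_⟩
    change flow X t (P ((flow X (-t) * flow X t) x)) = _
    rw [flow_neg_mul_flow]
    rfl

/-- The reflection of a geodesic. -/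
lemma two_smul_geodesic_sub_one {X P : H →L[ℂ] H} (hP : IsStarProjection P)
    (h : (2 • P - 1) * X = -(X * (2 • P - 1))) (t : ℝ) :
    2 • geodesic X P t - 1 = flow X (2 * t) * (2 • P - 1) := by
  have h1 := reflection_mul_flow (two_smul_sub_one_mul_self hP) h (-t)
  rw [neg_neg] at h1
  rw [two_mul, flow_add, mul_assoc, ← h1, geodesic, sub_mul, mul_sub, one_mul, flow_mul_flow_neg,
    smul_mul_assoc, mul_smul_comm, mul_assoc]

lemma geodesic_eq {X P : H →L[ℂ] H} (hP : IsStarProjection P)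
    (h : (2 • P - 1) * X = -(X * (2 • P - 1))) (t : ℝ) :
    geodesic X P t = (2⁻¹ : ℝ) • (1 + flow X (2 * t) * (2 • P - 1)) := by
  rw [← two_smul_geodesic_sub_one hP h]
  module

lemma hasDerivAt_flow_two_mul (X : H →L[ℂ] H) (t : ℝ) :
    HasDerivAt (fun s => flow X (2 * s)) ((2 : ℝ) • (flow X (2 * t) * (Complex.I • X))) t := by
  have := (hasDerivAt_flow X (2 * t)).scomp t ((hasDerivAt_id t).const_mul 2)
  rwa [mul_one] at this

lemma hasDerivAt_geodesic {X P : H →L[ℂ] H} (hP : IsStarProjection P)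
    (h : (2 • P - 1) * X = -(X * (2 • P - 1))) (t : ℝ) :
    HasDerivAt (geodesic X P) (flow X (2 * t) * (Complex.I • X) * (2 • P - 1)) t := by
  have h1 := (((hasDerivAt_flow_two_mul X t).mul_const (2 • P - 1)).const_add 1).const_smul
    (2⁻¹ : ℝ)
  rw [smul_mul_assoc, smul_smul, inv_mul_cancel₀ two_ne_zero, one_smul] at h1
  exact h1.congr_of_eventuallyEq (Eventually.of_forall fun s => geodesic_eq hP h s)

lemma norm_mul_reflection {T R : H →L[ℂ] H} (hR : IsSelfAdjoint R) (hR2 : R * R = 1) :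
    ‖T * R‖ = ‖T‖ :=
  CStarRing.norm_mul_mem_unitary T (Unitary.mem_iff.2 (by rw [hR.star_eq]; exact ⟨hR2, hR2⟩))

lemma norm_deriv_geodesic {X P : H →L[ℂ] H} (hX : IsSelfAdjoint X) (hP : IsStarProjection P)
    (h : (2 • P - 1) * X = -(X * (2 • P - 1))) (t : ℝ) : ‖deriv (geodesic X P) t‖ = ‖X‖ := by
  rw [(hasDerivAt_geodesic hP h t).deriv,
    norm_mul_reflection (isSelfAdjoint_two_smul_sub_one hP) (two_smul_sub_one_mul_self hP),
    CStarRing.norm_mem_unitary_mul, norm_smul, Complex.norm_I, one_mul]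
  rw [Unitary.mem_iff, star_flow hX]
  exact ⟨flow_neg_mul_flow X _, flow_mul_flow_neg X _⟩

lemma length_geodesic {X P : H →L[ℂ] H} (hX : IsSelfAdjoint X) (hP : IsStarProjection P)
    (h : (2 • P - 1) * X = -(X * (2 • P - 1))) : length (geodesic X P) = ‖X‖ := by
  simp [length, norm_deriv_geodesic hX hP h]

lemma contDiff_geodesic (X P : H →L[ℂ] H) : ContDiff ℝ ∞ (geodesic X P) :=
  ((contDiff_flow X).mul contDiff_const).mul ((contDiff_flow X).comp contDiff_neg)

/-- The second derivative is `2 (iX)²` times the reflection `2δ - 1`. Since `X²` commutes with that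
reflection, it commutes with `δ`, so its tangential part vanishes. -/
lemma isGeodesic_geodesic {X P : H →L[ℂ] H} (hX : IsSelfAdjoint X) (hP : IsStarProjection P)
    (h : (2 • P - 1) * X = -(X * (2 • P - 1))) : IsGeodesic (geodesic X P) := by
  refine ⟨fun t _ => geodesic_mem_Gr hX hP t, (contDiff_geodesic X P).contDiffOn, fun t ht => ?_⟩
  have hu : UniqueDiffOn ℝ (Icc (0 : ℝ) 1) := uniqueDiffOn_Icc zero_lt_one
  have h1 : ∀ s ∈ Icc (0 : ℝ) 1, derivWithin (geodesic X P) (Icc 0 1) s =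
      flow X (2 * s) * (Complex.I • X) * (2 • P - 1) := fun s hs =>
    (hasDerivAt_geodesic hP h s).hasDerivWithinAt.derivWithin (hu s hs)
  have h2 : derivWithin (derivWithin (geodesic X P) (Icc 0 1)) (Icc 0 1) t =
      (2 : ℝ) • (flow X (2 * t) * (Complex.I • X)) * (Complex.I • X) * (2 • P - 1) := by
    rw [derivWithin_congr h1 (h1 t ht)]
    exact ((((hasDerivAt_flow_two_mul X t).mul_const _).mul_const _).hasDerivWithinAt).derivWithin
      (hu t ht)
  rw [h2]
  have hR2 := two_smul_sub_one_mul_self hP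
  have hcf := commute_flow X (2 * t)
  have hD := two_smul_geodesic_sub_one hP h t
  set K := Complex.I • X with hK
  set R := 2 • P - 1 with hR
  set U := flow X (2 * t)
  have hKR : Commute (K * K) R := by
    change K * K * R = R * (K * K)
    rw [hK]
    simp only [smul_mul_assoc, mul_smul_comm]
    congr 2
    rw [← mul_assoc, h, neg_mul, mul_assoc, mul_assoc, h, mul_neg, neg_neg]
  have hT : (2 : ℝ) • (U * K) * K * R = (2 : ℝ) • (K * K * (U * R)) := by
    rw [smul_mul_assoc, smul_mul_assoc, hcf.eq, mul_assoc K U K, hcf.eq]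
    simp only [mul_assoc]
  have hc : Commute (geodesic X P t) ((2 : ℝ) • (K * K * (U * R))) := by
    have hD' : geodesic X P t = (2⁻¹ : ℝ) • (U * R + 1) := by
      rw [← hD]
      module
    have hKD : Commute (U * R) (K * K) := ((hcf.mul_right hcf).mul_left hKR.symm)
    rw [hD']
    exact ((((hKD.mul_right (Commute.refl _)).add_left (Commute.one_left _)).smul_left _).smul_right
      _)
  rw [hT]
  exact tangentProj_eq_zero_of_commute (geodesic_mem_Gr hX hP t).isIdempotentElem hc

lemma isPiecewiseSmoothCurve_of_contDiffOn {γ : ℝ → (H →L[ℂ] H)}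
    (hγ : ∀ t ∈ Icc (0 : ℝ) 1, γ t ∈ Gr H) (hs : ContDiffOn ℝ ∞ γ (Icc 0 1)) :
    IsPiecewiseSmoothCurve γ := by
  refine ⟨hγ, 1, fun n => n, Nat.mono_cast, by simp, by simp, fun i hi => ?_⟩
  obtain rfl : i = 0 := by omega
  simpa using hs

/-- Every geodesic is given by an exponent. -/
lemma IsGeodesic.exists_eqOn_geodesic {γ : ℝ → (H →L[ℂ] H)} (hγ : IsGeodesic γ) :
    ∃ Z : H →L[ℂ] H, IsSelfAdjoint Z ∧ (2 • γ 0 - 1) * Z = -(Z * (2 • γ 0 - 1)) ∧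
      EqOn γ (geodesic Z (γ 0)) (Icc 0 1) := by
  obtain ⟨hGr, hsm, hgeo⟩ := hγ
  have hu : UniqueDiffOn ℝ (Icc (0 : ℝ) 1) := uniqueDiffOn_Icc zero_lt_one
  have h0 : (0 : ℝ) ∈ Icc (0 : ℝ) 1 := by simp
  have hsm1 : ContDiffOn ℝ ∞ (derivWithin γ (Icc 0 1)) (Icc 0 1) :=
    hsm.derivWithin hu (by simp)
  set γ₁ := derivWithin γ (Icc 0 1) with hγ₁
  set γ₂ := derivWithin γ₁ (Icc 0 1)
  have hd1 : ∀ t ∈ Icc (0 : ℝ) 1, HasDerivWithinAt γ (γ₁ t) (Icc 0 1) t := fun t ht =>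
    (hsm.differentiableOn (by simp) t ht).hasDerivWithinAt
  have hd2 : ∀ t ∈ Icc (0 : ℝ) 1, HasDerivWithinAt γ₁ (γ₂ t) (Icc 0 1) t := fun t ht =>
    (hsm1.differentiableOn (by simp) t ht).hasDerivWithinAt
  have hid : ∀ t ∈ Icc (0 : ℝ) 1, γ t * γ t = γ t := fun t ht => (hGr t ht).isIdempotentElem.eq
  have e1 : ∀ t ∈ Icc (0 : ℝ) 1, γ₁ t * γ t + γ t * γ₁ t = γ₁ t := fun t ht =>
    (hu t ht).eq_deriv _ ((hd1 t ht).mul (hd1 t ht))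
      ((hd1 t ht).congr (fun s hs => hid s hs) (hid t ht))
  have e2 : ∀ t ∈ Icc (0 : ℝ) 1,
      γ₂ t * γ t + γ₁ t * γ₁ t + (γ₁ t * γ₁ t + γ t * γ₂ t) = γ₂ t := fun t ht =>
    (hu t ht).eq_deriv _ (((hd2 t ht).mul (hd1 t ht)).add ((hd1 t ht).mul (hd2 t ht)))
      ((hd2 t ht).congr (fun s hs => e1 s hs) (e1 t ht))
  -- Multiplying the geodesic equation by `γ t` on the left and on the right kills each off-diagonal
  -- block of `γ₂ t`.
  have hcomm : ∀ t ∈ Icc (0 : ℝ) 1, γ₂ t * γ t = γ t * γ₂ t := fun t ht => by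
    have h1 := hgeo t ht
    have hP := hid t ht
    change γ t * γ₂ t * (1 - γ t) + (1 - γ t) * γ₂ t * γ t = 0 at h1
    have l := congrArg (γ t * ·) h1
    have r := congrArg (· * γ t) h1
    simp only [mul_sub, sub_mul, mul_add, add_mul, mul_one, one_mul, ← mul_assoc, hP, mul_zero,
      zero_mul, sub_self, add_zero] at l r
    simp only [mul_assoc, hP, sub_self, zero_add] at l r
    rw [sub_eq_zero] at l r
    rw [r, l]
  -- Differentiating `γ² = γ` twice and using `hcomm` gives `2 γ₂ γ + 2 γ₁² = γ₂`, which says that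
  -- this derivative is zero.
  have hKd : ∀ t ∈ Icc (0 : ℝ) 1,
      HasDerivWithinAt (fun s => γ₁ s * (2 • γ s - 1)) 0 (Icc 0 1) t := fun t ht => by
    have h1 : HasDerivWithinAt (fun s => γ₁ s * (2 • γ s - 1))
        (γ₂ t * (2 • γ t - 1) + γ₁ t * (2 • γ₁ t)) (Icc 0 1) t :=
      (hd2 t ht).mul (((hd1 t ht).const_smul (2 : ℕ)).sub_const 1)
    have h2 := e2 t ht
    rw [← hcomm t ht, ← sub_eq_zero] at h2
    have h3 : γ₂ t * (2 • γ t - 1) + γ₁ t * (2 • γ₁ t) = 0 := by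
      rw [← h2]
      simp only [mul_sub, mul_one, mul_smul_comm]
      module
    rwa [h3] at h1
  have hK : ∀ t ∈ Icc (0 : ℝ) 1, γ₁ t * (2 • γ t - 1) = γ₁ 0 * (2 • γ 0 - 1) :=
    constant_of_derivWithin_zero (fun t ht => (hKd t ht).differentiableWithinAt)
      fun t ht => (hKd t (Ico_subset_Icc_self ht)).derivWithin (hu t (Ico_subset_Icc_self ht))
  have hP0 := hGr 0 h0
  have hR2 : ∀ t ∈ Icc (0 : ℝ) 1, (2 • γ t - 1) * (2 • γ t - 1) = 1 := fun t ht =>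
    two_smul_sub_one_mul_self (hGr t ht)
  have hRs : star (2 • γ 0 - 1) = 2 • γ 0 - 1 := isSelfAdjoint_two_smul_sub_one hP0
  have hsa1 : star (γ₁ 0) = γ₁ 0 := by
    refine (hu 0 h0).eq_deriv _ (hd1 0 h0).star ?_
    exact (hd1 0 h0).congr (fun s hs => (hGr s hs).isSelfAdjoint.star_eq) hP0.isSelfAdjoint.star_eq
  have hanti : (2 • γ 0 - 1) * γ₁ 0 = -(γ₁ 0 * (2 • γ 0 - 1)) := by
    have h1 := sub_eq_zero.2 (e1 0 h0)
    have h2 : (2 • γ 0 - 1) * γ₁ 0 + γ₁ 0 * (2 • γ 0 - 1) =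
        2 • (γ₁ 0 * γ 0 + γ 0 * γ₁ 0 - γ₁ 0) := by
      simp only [mul_sub, sub_mul, mul_one, one_mul, mul_smul_comm, smul_mul_assoc]
      module
    rw [eq_neg_iff_add_eq_zero, h2, h1, smul_zero]
  set R := 2 • γ 0 - 1 with hR
  set K := γ₁ 0 * R with hKdef
  have hK1 : ∀ t ∈ Icc (0 : ℝ) 1, γ₁ t = K * (2 • γ t - 1) := fun t ht => by
    rw [← hK t ht, mul_assoc, hR2 t ht, mul_one]
  have hKs : star K = -K := by rw [hKdef, star_mul, hRs, hsa1, hanti]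
  let Z : H →L[ℂ] H := (-Complex.I) • K
  have hIZ : Complex.I • Z = K := by simp [Z, smul_smul]
  have hZ : IsSelfAdjoint Z := by
    rw [IsSelfAdjoint, star_smul, hKs]
    simp [Z]
  have hRZ : R * Z = -(Z * R) := by
    simp only [Z, mul_smul_comm, smul_mul_assoc]
    rw [← smul_neg, hKdef, ← mul_assoc, hanti, neg_mul]
  refine ⟨Z, hZ, hRZ, fun t ht => ?_⟩
  -- The reflection solves `(2γ - 1)' = 2K(2γ - 1)` with `K = iZ`; the integrating factor `exp
  -- (-2tK)` makes it constant.
  have hGd : ∀ t ∈ Icc (0 : ℝ) 1,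
      HasDerivWithinAt (fun s => flow Z (2 * -s) * (2 • γ s - 1)) 0 (Icc 0 1) t := fun t ht => by
    have hf := ((hasDerivAt_flow_two_mul Z (-t)).scomp t (hasDerivAt_neg t)).hasDerivWithinAt
      (s := Icc 0 1)
    have h1 : HasDerivWithinAt (fun s => flow Z (2 * -s) * (2 • γ s - 1))
        ((-1 : ℝ) • (2 : ℝ) • (flow Z (2 * -t) * (Complex.I • Z)) * (2 • γ t - 1)
          + flow Z (2 * -t) * (2 • γ₁ t)) (Icc 0 1) t :=
      hf.mul (((hd1 t ht).const_smul (2 : ℕ)).sub_const 1)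
    rw [hIZ, hK1 t ht] at h1
    have h2 : (-1 : ℝ) • (2 : ℝ) • (flow Z (2 * -t) * K) * (2 • γ t - 1)
        + flow Z (2 * -t) * (2 • (K * (2 • γ t - 1))) = 0 := by
      simp only [smul_mul_assoc, mul_smul_comm, mul_assoc]
      module
    rwa [h2] at h1
  have hG := constant_of_derivWithin_zero (fun t ht => (hGd t ht).differentiableWithinAt)
      (fun t ht => (hGd t (Ico_subset_Icc_self ht)).derivWithin (hu t (Ico_subset_Icc_self ht))) t ht
  simp only [neg_zero, mul_zero, flow_zero, one_mul] at hG
  have h3 : 2 • γ t - 1 = flow Z (2 * t) * R := by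
    rw [hR, ← hG, ← mul_assoc, mul_neg, flow_mul_flow_neg, one_mul]
  rw [geodesic_eq hP0 hRZ, ← hR, ← h3]
  module

/-- Operators exchanging two reflections exchange the corresponding projections. -/
lemma flow_one_mul_reflection {Z P Q : H →L[ℂ] H} (h : geodesic Z P 1 = Q) :
    NormedSpace.exp (Complex.I • Z) * (2 • P - 1) = (2 • Q - 1) * NormedSpace.exp (Complex.I • Z) := by
  rw [← h, ← flow_one, geodesic, sub_mul, mul_sub, mul_smul_comm, smul_mul_assoc,
    mul_assoc _ _ (flow Z 1), flow_neg_mul_flow, mul_one, mul_one, one_mul]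

lemma geodesic_one_of_reflection {Z P Q : H →L[ℂ] H}
    (h : NormedSpace.exp (Complex.I • Z) * (2 • P - 1) =
      (2 • Q - 1) * NormedSpace.exp (Complex.I • Z)) : geodesic Z P 1 = Q := by
  rw [← flow_one, mul_sub, sub_mul, mul_one, one_mul, mul_smul_comm, smul_mul_assoc] at h
  have h1 : flow Z 1 * P = Q * flow Z 1 := by
    have h2 : (2 : ℕ) • (flow Z 1 * P) = (2 : ℕ) • (Q * flow Z 1) := sub_left_injective h
    exact eq_of_two_nsmul_eq h2
  rw [geodesic, h1, mul_assoc, flow_mul_flow_neg, mul_one]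

section Subspaces

variable {S T : Submodule ℂ H} [S.HasOrthogonalProjection] [T.HasOrthogonalProjection]

lemma eq_starProjection_of_range_eq {P : H →L[ℂ] H} (hP : IsStarProjection P)
    (h : P.range = S) : P = S.starProjection := by
  subst h
  obtain ⟨_, h⟩ := isStarProjection_iff_eq_starProjection_range.1 hP
  exact h

/-- `exp (iX) S` is the range of the projection `geodesic X P 1`, and an orthogonal projection is
determined by its range. -/
lemma map_exp_eq_iff {X : H →L[ℂ] H} (hX : IsSelfAdjoint X) :
    S.map (NormedSpace.exp (Complex.I • X)).toLinearMap = T ↔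
      geodesic X S.starProjection 1 = T.starProjection := by
  have h1 := range_geodesic X S.starProjection 1
  rw [Submodule.range_starProjection, flow_one] at h1
  have hP : IsStarProjection S.starProjection := isStarProjection_starProjection
  constructor
  · intro h
    exact eq_starProjection_of_range_eq (geodesic_mem_Gr hX hP 1) (h1.trans h)
  · intro h
    rw [← h1, h, Submodule.range_starProjection]

/-- Two closed subspaces in general position are joined by a unique minimal geodesic of the
Grassmann manifold. -/
theorem exists_unique_minimalGeodesic (h₁ : S ⊓ Tᗮ = ⊥) (h₂ : Sᗮ ⊓ T = ⊥) :
    ∃ X : H →L[ℂ] H, IsGeodesicExponent X S T ∧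
      (∀ Y : H →L[ℂ] H, IsGeodesicExponent Y S T → Y = X) ∧
      ∃ δ : ℝ → (H →L[ℂ] H), IsMinimalGeodesic δ S T ∧
        (∀ γ : ℝ → (H →L[ℂ] H), IsMinimalGeodesic γ S T → EqOn γ δ (Icc 0 1)) ∧
        ∀ t ∈ Icc (0 : ℝ) 1, (δ t).range =
          S.map (NormedSpace.exp ((Complex.I * (t : ℂ)) • X)).toLinearMap := by
  have hP : IsStarProjection S.starProjection := isStarProjection_starProjection
  have hQ : IsStarProjection T.starProjection := isStarProjection_starProjection
  have hRs := isSelfAdjoint_two_smul_sub_one hP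
  have hR2 := two_smul_sub_one_mul_self hP
  have hinj := injective_reflection_add_reflection h₁ h₂
  obtain ⟨X, hX, hXn, hXR, hXR', hXe⟩ := exists_exponent hRs hR2
    (isSelfAdjoint_two_smul_sub_one hQ) (two_smul_sub_one_mul_self hQ) hinj
  have hX1 := geodesic_one_of_reflection hXe
  have huniq : ∀ Y : H →L[ℂ] H, IsSelfAdjoint Y → ‖Y‖ ≤ Real.pi / 2 →
      (2 • S.starProjection - 1) * Y = -(Y * (2 • S.starProjection - 1)) →
      geodesic Y S.starProjection 1 = T.starProjection → Y = X := fun Y hY hYn hYR hY1 =>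
    exponent_unique hRs hR2 hinj hY hYn hYR (flow_one_mul_reflection hY1) hX hXn hXR hXe
  have hgeo := isGeodesic_geodesic hX hP hXR
  have hjoin : Joins (geodesic X S.starProjection) S T := by
    rw [Joins, geodesic_zero, hX1, Submodule.range_starProjection, Submodule.range_starProjection]
    exact ⟨rfl, rfl⟩
  have hends : ∀ β : ℝ → (H →L[ℂ] H), (∀ t ∈ Icc (0 : ℝ) 1, β t ∈ Gr H) → Joins β S T →
      β 0 = S.starProjection ∧ β 1 = T.starProjection := fun β hβ hJ =>
    ⟨eq_starProjection_of_range_eq (hβ 0 (by simp)) hJ.1,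
      eq_starProjection_of_range_eq (hβ 1 (by simp)) hJ.2⟩
  refine ⟨X, ⟨hX, hXn, (codiagonal_iff X).2 hXR, (codiagonal_iff X).2 hXR',
    (map_exp_eq_iff hX).2 hX1⟩, fun Y hY => ?_, geodesic X S.starProjection,
    ⟨hgeo, hjoin, fun β hβ hJ => ?_⟩, fun γ hγ => ?_, fun t _ => ?_⟩
  · exact huniq Y hY.selfAdjoint hY.norm_le ((codiagonal_iff Y).1 hY.codiagonal_left)
      ((map_exp_eq_iff hY.selfAdjoint).1 hY.map_eq)
  · obtain ⟨hβ0, hβ1⟩ := hends β hβ.1 hJ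
    rw [length_geodesic hX hP hXR]
    exact norm_le_length hβ hX hXn (by rw [hβ0]; exact hXR) (by rw [hβ0, hβ1]; exact hXe)
  · obtain ⟨hγ1, hγ2, hγ3⟩ := hγ
    obtain ⟨e0, e1⟩ := hends γ hγ1.1 hγ2
    obtain ⟨Z, hZ, hRZ, hγZ⟩ := hγ1.exists_eqOn_geodesic
    rw [e0] at hRZ hγZ
    -- The curves agree only on `[0,1]`, so their derivatives are compared on the open interval.
    have hlen : length γ = ‖Z‖ := by
      rw [← length_geodesic hZ hP hRZ, length, length,
        intervalIntegral.integral_of_le zero_le_one, intervalIntegral.integral_of_le zero_le_one,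
        integral_Ioc_eq_integral_Ioo, integral_Ioc_eq_integral_Ioo]
      refine setIntegral_congr_fun measurableSet_Ioo fun t ht => ?_
      have : γ =ᶠ[𝓝 t] geodesic Z S.starProjection :=
        hγZ.eventuallyEq_of_mem (Icc_mem_nhds ht.1 ht.2)
      simp only [this.deriv_eq]
    have hle := hγ3 _ (isPiecewiseSmoothCurve_of_contDiffOn hgeo.1 hgeo.2.1) hjoin
    rw [hlen, length_geodesic hX hP hXR] at hle
    have hZ1 : geodesic Z S.starProjection 1 = T.starProjection := by
      rw [← hγZ (by simp), e1]
    -- Minimality gives `‖Z‖ ≤ ‖X‖ ≤ π/2`, which is what makes uniqueness of the exponent applicable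
    -- to `Z`.
    rwa [huniq Z hZ (hle.trans hXn) hRZ hZ1] at hγZ
  · rw [range_geodesic, Submodule.range_starProjection, flow, mul_comm, mul_smul, Complex.coe_smul]

end Subspaces

end Grassmann

end

theorem proposition5p2 (a b : Set ℂ)
    (ha : Hardy.IsInfiniteBlaschkeSet a) (hb : Hardy.IsInfiniteBlaschkeSet b)
    (hab : Disjoint a b)
    (hlim : ¬ Hardy.limitSet a ⊆ Hardy.limitSet b)
    (hlim' : ¬ Hardy.limitSet b ⊆ Hardy.limitSet a) :
    Hardy.zeroSpace a ⊓ (Hardy.zeroSpace b)ᗮ = ⊥ ∧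
    (Hardy.zeroSpace a)ᗮ ⊓ Hardy.zeroSpace b = ⊥ ∧
    ∃ X : Hardy.H2 →L[ℂ] Hardy.H2,
      Grassmann.IsGeodesicExponent X (Hardy.zeroSpace a) (Hardy.zeroSpace b) ∧
      (∀ Y : Hardy.H2 →L[ℂ] Hardy.H2,
        Grassmann.IsGeodesicExponent Y (Hardy.zeroSpace a) (Hardy.zeroSpace b) → Y = X) ∧
      ∃ δ : ℝ → (Hardy.H2 →L[ℂ] Hardy.H2),
        Grassmann.IsMinimalGeodesic δ (Hardy.zeroSpace a) (Hardy.zeroSpace b) ∧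
        (∀ γ : ℝ → (Hardy.H2 →L[ℂ] Hardy.H2),
          Grassmann.IsMinimalGeodesic γ (Hardy.zeroSpace a) (Hardy.zeroSpace b) →
            Set.EqOn γ δ (Set.Icc 0 1)) ∧
        ∀ t ∈ Set.Icc (0 : ℝ) 1, (δ t).range =
          (Hardy.zeroSpace a).map
            (NormedSpace.exp ((Complex.I * (t : ℂ)) • X)).toLinearMap := by
  have h₁ := Hardy.zeroSpace_inf_orthogonal_eq_bot ha hb hlim
  have h₂ := Hardy.zeroSpace_inf_orthogonal_eq_bot hb ha hlim'
  rw [inf_comm] at h₂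
  -- Completeness of the closed subspaces supplies their orthogonal projections.
  have := (Hardy.isClosed_zeroSpace ha.subset).completeSpace_coe
  have := (Hardy.isClosed_zeroSpace hb.subset).completeSpace_coe
  exact ⟨h₁, h₂, Grassmann.exists_unique_minimalGeodesic h₁ h₂⟩
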